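/- **Setting.** Let $K\ge 1$, $M\ge 0$, $\eta>2$, $\sigma^2\ge 0$. A user at the origin of $\mathbb R^2$ is served by $K$ transmitters at given distances $0<d_1\le\dots\le d_K$ (repetitions allowed). Transmitter $i$ is active ($\mathbb 1_i=1$) with probability $1-q_i$, where $q_i\in(0,1]$. The interferers form $M+1$ independent homogeneous Poisson point processes: tier $0$, of intensity $\lambda_0>0$ on $\{|x|>d_K\}$ (the out-of-cluster transmitters), and tiers $m=1,\dots,M$, of intensity $\lambda_m>0$ on $\mathbb R^2$. A node of tier $m$ is active with probability $p_m\in[0,1]$ and has power $P_m>0$, with $P_0=1$. All links have $\exp(1)$ fading powers $H$; all activity indicators, fading powers and point processes are mutually independent. Put $$\gamma=\frac{\sum_{i=1}^K\mathbb 1_i d_i^{-\eta}H_i}{I+\sigma^2},\qquad I=\sum_{m=0}^M\sum_{x\in\Phi_m}\mathbb 1_{x}P_m|x|^{-\eta}H_{x},$$ where $\gamma=\infty$ if $I+\sigma^2=0$ and the numerator is positive, and $\gamma=0$ if $I+\sigma^2=0$ and the numerator is $0$. Let $\omega_i=d_i/d_K$, let $\delta_1,\dots,\delta_\tau$ be the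 different values among the $\omega_i$, with multiplicities $n_1,\dots,n_\tau$, let $\Omega=\{\omega_i^\eta\}_{i\le K}$ and $\hat\Omega=\{\omega_i^\eta/q_i\}_{i\le K}$ (multisets), $G=\prod_i q_i$, $\alpha_m(S)=(-1)^m e_{K-m}(S)$ with $e_j$ the $j$-th elementary symmetric polynomial, and $$A_m(n_u,v)=(-1)^{n_u-v}\delta_u^{-v\eta}\sum_{k_1+\dots+k_\tau=n_u-v}\binom{m}{k_u}\delta_u^{\eta(m-k_u)}\prod_{j\ne u}\binom{n_j+k_j-1}{k_j}(\delta_j^\eta-\delta_u^\eta)^{-(n_j+k_j)},$$ $$c_{u,v}=\sum_{m=0}^{K-1}\bigl(\alpha_m(\hat\Omega)-\alpha_m(\Omega)\bigr)A_m(n_u,v).$$ Let $\mathcal Q(v,x)=\frac1{\Gamma(v)}\int_x^\infty t^{v-1}e^{-t}\,dt$, $\kappa=\kappa_v=(v!)^{-1/v}$, $a_v(x)=1-(1-e^{-\kappa_v x})^v$, and $$B_{u,v}(\theta)=\sum_{\ell=1}^v\binom v\ell(-1)^{\ell+1}\Delta_{u,\ell}(\theta),$$ $$\Delta_{u,\ell}(\theta)=e^{-\theta\kappa\ell(d_K\delta_u)^\eta\sigma^2}\,e^{-\pi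 p_0\lambda_0d_K^2\mathcal F(\delta_u^\eta\theta\kappa\ell,\eta)}\prod_{m=1}^M e^{-\pi p_m\lambda_m\delta_u^2d_K^2(\theta\kappa\ell P_m)^{2/\eta}\Gamma(1+2/\eta)\Gamma(1-2/\eta)},$$ with $\mathcal F(t,\eta)=\frac{2t}{\eta-2}\,{}_2F_1(1,1-\tfrac2\eta;2-\tfrac2\eta;-t)$. **Theorem.** (1) The normalized signal $S_K=\sum_i\mathbb 1_i\omega_i^{-\eta}H_i$, a sum of Bernoulli-gated exponentials, satisfies, for every $x\ge0$, $\Pr[S_K>x]=G\sum_{u=1}^\tau\sum_{v=1}^{n_u}c_{u,v}\,\mathcal Q(v,\delta_u^\eta x)$. (2) $I<\infty$ almost surely, and for every $\theta\ge0$, $$\Pr[\gamma>\theta]=G\sum_{u=1}^\tau\sum_{v=1}^{n_u}c_{u,v}\,\mathbb E\bigl[\mathcal Q(v,\delta_u^\eta d_K^\eta\theta(I+\sigma^2))\bigr].$$ (3) Alzer's bound $\mathcal Q(v,x)\le a_v(x)$ holds for all integers $v\ge1$ and all $x\ge0$, and for all $\theta\ge 0$, $u\le\tau$, $v\le n_u$,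 $$\mathbb E\bigl[\mathcal Q(v,\delta_u^\eta d_K^\eta\theta(I+\sigma^2))\bigr]\le\mathbb E\bigl[a_v(\delta_u^\eta d_K^\eta\theta(I+\sigma^2))\bigr]=B_{u,v}(\theta).$$ (4) Consequently, replacing each $\mathbb E[\mathcal Q(v,\cdot)]$ in (2) by its Alzer bound yields the closed-form approximation $G\sum_{u}\sum_{v}c_{u,v}B_{u,v}(\theta)$ of the SINR CCDF, and for every $\theta\ge0$ $$\Bigl|\Pr[\gamma>\theta]-G\sum_{u=1}^\tau\sum_{v=1}^{n_u}c_{u,v}B_{u,v}(\theta)\Bigr|\le G\sum_{u=1}^\tau\sum_{v=1}^{n_u}|c_{u,v}|\,\sup_{x\ge0}\bigl(a_v(x)-\mathcal Q(v,x)\bigr),$$ a bound that does not depend on $\theta$, the noise or the interference (its terms with $v=1$ vanish). -/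

import Mathlib

open MeasureTheory ProbabilityTheory
open scoped ENNReal NNReal

noncomputable section

namespace EHCluster

/-! ### Special functions -/

/-- Regularized upper incomplete Gamma function `Q(a, x) = Γ(a)⁻¹ ∫_x^∞ t^(a-1) e^(-t) dt`. -/
def gammaQ (a x : ℝ) : ℝ :=
  (Real.Gamma a)⁻¹ * ∫ t in Set.Ioi x, t ^ (a - 1) * Real.exp (-t)

/-- The constant `κ = (v!)^(-1/v)`. -/
def kappa (v : ℕ) : ℝ := (v.factorial : ℝ) ^ (-(1 / (v : ℝ)))

/-- Alzer's bound `1 - (1 - e^(-κ x))^v`. -/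
def alzer (v : ℕ) (x : ℝ) : ℝ := 1 - (1 - Real.exp (-(kappa v * x))) ^ v

/-- The largest error made when `Q(v, ·)` is replaced by Alzer's bound on the half-line `[0, ∞)`. -/
def alzerGap (v : ℕ) : ℝ := sSup ((fun x : ℝ => alzer v x - gammaQ v x) '' Set.Ici 0)

/-- Gauss hypergeometric function `₂F₁(a, b; c; z)` for real `c > b > 0` and real `z < 1`, through
Euler's integral. (The power series only covers `|z| < 1`, while `z ≤ -1` is needed as well.) -/
def gauss2F1 (a b c z : ℝ) : ℝ :=
  Real.Gamma c / (Real.Gamma b * Real.Gamma (c - b)) *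
    ∫ t in (0 : ℝ)..1, t ^ (b - 1) * (1 - t) ^ (c - b - 1) * (1 - z * t) ^ (-a)

/-- `𝓕(t₁, t₂) = 2 t₁ / (t₂ - 2) · ₂F₁(1, 1 - 2/t₂; 2 - 2/t₂; -t₁)`. -/
def calF (t₁ t₂ : ℝ) : ℝ :=
  2 * t₁ / (t₂ - 2) * gauss2F1 1 (1 - 2 / t₂) (2 - 2 / t₂) (-t₁)

/-! ### Poisson point processes -/

/-- The plane. -/
abbrev Plane := EuclideanSpace ℝ (Fin 2)

/-- Number of points of the enumerated point process `X` in the set `B`. -/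
def count {Ω : Type*} (X : ℕ → Ω → Plane) (B : Set Plane) (ω : Ω) : ℝ≥0∞ :=
  Measure.sum (fun i => Measure.dirac (X i ω)) B

/-- `X` enumerates a Poisson point process with intensity measure `Λ`: the number of points in a
measurable set of finite intensity is Poisson, and the numbers of points in disjoint measurable
sets are independent. -/
structure IsPoissonProcess {Ω : Type*} [MeasurableSpace Ω] (X : ℕ → Ω → Plane)
    (Λ : Measure Plane) (μ : Measure Ω) : Prop where
  measurable : ∀ i, Measurable (X i)
  poisson : ∀ B : Set Plane, MeasurableSet B → Λ B < ∞ →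
    HasLaw (count X B) ((poissonMeasure (Λ B).toNNReal).map (fun n : ℕ => (n : ℝ≥0∞))) μ
  indep : ∀ (n : ℕ) (B : Fin n → Set Plane), (∀ j, MeasurableSet (B j)) →
    Pairwise (Function.onFun Disjoint B) → iIndepFun (fun j => count X (B j)) μ

/-! ### Parameters of the network -/

/-- Deterministic parameters of a network with cluster size `K` and `M` interfering tiers. Index `0`
in `Fin (M + 1)` is the tier of the transmitters (its out-of-cluster nodes), the indices
`1, …, M` are the other interfering tiers. -/
structure Params (K M : ℕ) where
  /-- path-loss exponent -/
  η : ℝ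
  /-- noise power `σ²` -/
  noise : ℝ
  /-- distances of the in-cluster transmitters from the user, in ascending order -/
  d : Fin K → ℝ
  /-- `q i` is one minus the transmission probability of the `i`-th in-cluster transmitter -/
  q : Fin K → ℝ
  /-- intensities of the tiers -/
  lam : Fin (M + 1) → ℝ
  /-- transmission probabilities of the interfering nodes of each tier -/
  ptr : Fin (M + 1) → ℝ
  /-- normalized transmit powers of the tiers -/
  P : Fin (M + 1) → ℝ
  K_pos : 0 < K
  η_gt : 2 < η
  noise_nonneg : 0 ≤ noise
  d_pos : ∀ i, 0 < d i
  d_mono : Monotone d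
  q_pos : ∀ i, 0 < q i
  q_le : ∀ i, q i ≤ 1
  lam_pos : ∀ m, 0 < lam m
  ptr_nonneg : ∀ m, 0 ≤ ptr m
  ptr_le : ∀ m, ptr m ≤ 1
  P_pos : ∀ m, 0 < P m
  P_zero : P 0 = 1

namespace Params

variable {K M : ℕ} (N : Params K M)

/-- The distance `d_K` of the farthest in-cluster transmitter. -/
def dK : ℝ := N.d ⟨K - 1, Nat.sub_lt N.K_pos Nat.one_pos⟩

/-- Normalized distances `ω_i = d_i / d_K`. -/
def nd (i : Fin K) : ℝ := N.d i / N.dK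

/-- `G`, the product of the `q_i`. -/
def G : ℝ := ∏ i, N.q i

/-- The multiset `Ω` of the `ω_i ^ η`. -/
def Om : Multiset ℝ := Finset.univ.val.map fun i => N.nd i ^ N.η

/-- The multiset `Ω̂` of the `ω_i ^ η / q_i`. -/
def OmHat : Multiset ℝ := Finset.univ.val.map fun i => N.nd i ^ N.η / N.q i

/-- `α_m(S) = (-1)^m` times the sum of all products of `K - m` elements of the multiset `S`. -/
def alpha (_N : Params K M) (S : Multiset ℝ) (m : ℕ) : ℝ := (-1) ^ m * S.esymm (K - m)

/-- The set `{δ_1, …, δ_τ}` of the different normalized distances. Sums and products over the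
indices `1, …, τ` are written below as sums and products over this set. -/
def deltas : Finset ℝ := Finset.univ.image N.nd

/-- The multiplicity of `δ` among the normalized distances (equivalently, that of `δ^η` in `Ω`). -/
def mult (δ : ℝ) : ℕ := (Finset.univ.filter fun i => N.nd i = δ).card

/-- The coefficient `A_m(n_u, v)` for `δ = δ_u`; `k` runs over the families of non-negative integers
indexed by the different normalized distances that add up to `n_u - v`. -/
def A (m : ℕ) (δ : ℝ) (v : ℕ) : ℝ :=
  (-1) ^ (N.mult δ - v) * δ ^ (-(v * N.η)) *
    ∑ k ∈ Finset.piAntidiag N.deltas (N.mult δ - v),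
      (m.choose (k δ) : ℝ) * δ ^ (N.η * ((m : ℝ) - (k δ : ℝ))) *
        ∏ ε ∈ N.deltas.erase δ,
          ((N.mult ε + k ε - 1).choose (k ε) : ℝ) *
            ((ε ^ N.η - δ ^ N.η) ^ (N.mult ε + k ε))⁻¹

/-- The coefficient `∑_{m=0}^{K-1} (α_m(Ω̂) - α_m(Ω)) A_m(n_u, v)`. -/
def coeff (δ : ℝ) (v : ℕ) : ℝ :=
  ∑ m ∈ Finset.range K, (N.alpha N.OmHat m - N.alpha N.Om m) * N.A m δ v

/-- The factor `Ψ_u(M)` of the interfering tiers `1, …, M`. -/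
def Psi (δ : ℝ) (v l : ℕ) (θ : ℝ) : ℝ :=
  ∏ m : Fin M, Real.exp (-(Real.pi * N.ptr m.succ * N.lam m.succ * δ ^ 2 * N.dK ^ 2 *
    (θ * kappa v * l * N.P m.succ) ^ (2 / N.η) *
      Real.Gamma (1 + 2 / N.η) * Real.Gamma (1 - 2 / N.η)))

/-- `Δ_{u,ℓ}(θ)`, with `κ = (v!)^(-1/v)`. -/
def Delta (δ : ℝ) (v l : ℕ) (θ : ℝ) : ℝ :=
  Real.exp (-(θ * kappa v * l * (N.dK * δ) ^ N.η * N.noise)) *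
    Real.exp (-(Real.pi * N.ptr 0 * N.lam 0 * N.dK ^ 2 *
      calF (δ ^ N.η * θ * kappa v * l) N.η)) *
    N.Psi δ v l θ

/-- `B_{u,v}(θ)`. -/
def B (δ : ℝ) (v : ℕ) (θ : ℝ) : ℝ :=
  ∑ l ∈ Finset.Icc 1 v, (v.choose l : ℝ) * (-1) ^ (l + 1) * N.Delta δ v l θ

/-- The closed-form approximation of the CCDF of the SINR. -/
def approxCCDF (θ : ℝ) : ℝ :=
  N.G * ∑ δ ∈ N.deltas, ∑ v ∈ Finset.Icc 1 (N.mult δ), N.coeff δ v * N.B δ v θ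

/-- Where the interfering nodes of each tier live: the out-of-cluster nodes of tier `0` are farther
from the user (at the origin) than `d_K`, the other tiers occupy the whole plane. -/
def region (m : Fin (M + 1)) : Set Plane :=
  if m = 0 then {x | N.dK < ‖x‖} else Set.univ

end Params

/-! ### Random quantities of the network -/

/-- The random quantities: transmission indicators and fading power gains of the in-cluster
transmitters, and positions, transmission indicators and fading power gains of the interferers. -/
structure Vars (Ω : Type*) (K M : ℕ) where
  on : Fin K → Ω → Bool
  H : Fin K → Ω → ℝ
  X : Fin (M + 1) → ℕ → Ω → Plane
  onI : Fin (M + 1) → ℕ → Ω → Bool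
  HI : Fin (M + 1) → ℕ → Ω → ℝ

/-- Labels of the independent sources of randomness. The positions of all the nodes of a tier form
one source. -/
inductive Source (K M : ℕ) : Type
  | on (i : Fin K)
  | H (i : Fin K)
  | X (m : Fin (M + 1))
  | onI (m : Fin (M + 1)) (i : ℕ)
  | HI (m : Fin (M + 1)) (i : ℕ)

namespace Vars

variable {Ω : Type*} {K M : ℕ} (W : Vars Ω K M)

/-- The σ-algebra generated by a source of randomness. -/
@[reducible] def sigmaAlg : Source K M → MeasurableSpace Ω
  | .on i => MeasurableSpace.comap (W.on i) inferInstance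
  | .H i => MeasurableSpace.comap (W.H i) inferInstance
  | .X m => ⨆ i, MeasurableSpace.comap (W.X m i) inferInstance
  | .onI m i => MeasurableSpace.comap (W.onI m i) inferInstance
  | .HI m i => MeasurableSpace.comap (W.HI m i) inferInstance

end Vars

/-- The network model: the in-cluster distances are given, the interferers of each tier form a
homogeneous Poisson process on their region, transmission indicators are Bernoulli, fading power
gains are exponential with mean one, and everything is independent. -/
structure IsModel {Ω : Type*} [MeasurableSpace Ω] {K M : ℕ} (N : Params K M) (W : Vars Ω K M)
    (μ : Measure Ω) : Prop where
  meas_on : ∀ i, Measurable (W.on i)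
  meas_H : ∀ i, Measurable (W.H i)
  meas_onI : ∀ m i, Measurable (W.onI m i)
  meas_HI : ∀ m i, Measurable (W.HI m i)
  prob_on : ∀ i, μ.real {ω | W.on i ω = true} = 1 - N.q i
  law_H : ∀ i, HasLaw (W.H i) (expMeasure 1) μ
  poisson : ∀ m, IsPoissonProcess (W.X m)
    (ENNReal.ofReal (N.lam m) • volume.restrict (N.region m)) μ
  prob_onI : ∀ m i, μ.real {ω | W.onI m i ω = true} = N.ptr m
  law_HI : ∀ m i, HasLaw (W.HI m i) (expMeasure 1) μ
  indep : iIndep W.sigmaAlg μ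

namespace Params

variable {Ω : Type*} {K M : ℕ} (N : Params K M) (W : Vars Ω K M)

/-- The received signal power `∑_i 1_i d_i^(-η) H_i`. -/
def signal (ω : Ω) : ℝ :=
  ∑ i, if W.on i ω then N.d i ^ (-N.η) * W.H i ω else 0

/-- The normalized signal power `S_K = ∑_i 1_i ω_i^(-η) H_i`. -/
def normSignal (ω : Ω) : ℝ :=
  ∑ i, if W.on i ω then N.nd i ^ (-N.η) * W.H i ω else 0

/-- The aggregate interference power `I`, with values in `[0, ∞]`. -/
def interference (ω : Ω) : ℝ≥0∞ :=
  ∑ m, ∑' i, if W.onI m i ω then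
    ENNReal.ofReal (N.P m * ‖W.X m i ω‖ ^ (-N.η) * W.HI m i ω) else 0

/-- The SINR `γ`, with values in `[0, ∞]` (it is `∞` when a positive signal meets neither
interference nor noise). -/
def sinr (ω : Ω) : ℝ≥0∞ :=
  ENNReal.ofReal (N.signal W ω) / (N.interference W ω + ENNReal.ofReal N.noise)

/-- The random variable `δ^η d_K^η θ (I + σ²)`. -/
def load (δ θ : ℝ) (ω : Ω) : ℝ :=
  δ ^ N.η * N.dK ^ N.η * θ * ((N.interference W ω).toReal + N.noise)

/-- The CCDF of the SINR, `θ ↦ Pr[γ > θ]`. -/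
def ccdf [MeasurableSpace Ω] (μ : Measure Ω) (θ : ℝ) : ℝ :=
  μ.real {ω | ENNReal.ofReal θ < N.sinr W ω}

end Params

end EHCluster

end

namespace EHCluster

/-! ### The regularized incomplete Gamma function -/

/-! Signal. Put `z = -it`. A gated exponential with rate `a = ω_i^η` has characteristic function
`q_i (z + a/q_i)/(z + a)`, so that of the normalized signal is `G` times a quotient of two monic
polynomials of degree `K` in `z`. The quotient is `1` plus a proper fraction, whose partial
fractions (`prod_div_prod_eq`) are multiples of `(δ^η/(z + δ^η))^v`, the characteristic functions of
Gamma laws. Uniqueness of characteristic functions, applied after the negative weights have changed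
sides (`measureReal_eq_add_sum_of_charFun`), yields the law: an atom of mass `G` at `0`, invisible
to the tail on `(x, ∞)`, plus a signed mixture of Gamma laws.

SINR. Where the interference is finite, `γ > θ` says that the normalized signal exceeds `d_K^η θ (I
+ σ²)`. Signal and interference are generated by disjoint sets of sources, so the tail formula can
be integrated over the law of `I`.

Interference. Averaging over the marks one at a time (`lintegral_mul_prod_markFactor`) leaves a
functional of the positions, to which the Laplace functional of a Poisson process
(`IsPoissonProcess.laplace`) applies. Its exponent is a radial integral: over the plane it is a
product of two Gamma values, outside a disc it is Euler's integral for `₂F₁`. Letting `s → 0` in the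
transform shows that `I` is almost surely finite.

Alzer. The gap between the bound and `Q(v, ·)` vanishes at `0` and at infinity. The sign of its
derivative is that of a decreasing function, so the gap cannot fall below `0` and come back. By the
binomial theorem the bound is a combination of exponentials, whose expectations are values of the
Laplace transform of `I`; this is the closed form. The error estimate then follows term by term. -/

lemma integrableOn_gamma_integrand {a : ℝ} (ha : 0 < a) :
    IntegrableOn (fun t : ℝ => t ^ (a - 1) * Real.exp (-t)) (Set.Ioi 0) := by
  simpa only [mul_comm] using Real.GammaIntegral_convergent ha

lemma gammaQ_eq_one_sub {a : ℝ} (ha : 0 < a) {x : ℝ} (hx : 0 ≤ x) :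
    gammaQ a x = 1 - (Real.Gamma a)⁻¹ * ∫ t in (0 : ℝ)..x, t ^ (a - 1) * Real.exp (-t) := by
  have h := intervalIntegral.integral_interval_add_Ioi (integrableOn_gamma_integrand ha)
    ((integrableOn_gamma_integrand ha).mono_set (Set.Ioi_subset_Ioi hx))
  have hG : ∫ t in Set.Ioi (0 : ℝ), t ^ (a - 1) * Real.exp (-t) = Real.Gamma a := by
    rw [Real.Gamma_eq_integral ha]
    simp only [mul_comm]
  have hpos := (Real.Gamma_pos_of_pos ha).ne'
  unfold gammaQ
  rw [hG] at h
  rw [eq_sub_iff_add_eq, ← mul_add, add_comm, h, inv_mul_cancel₀ hpos]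

lemma gammaQ_zero {a : ℝ} (ha : 0 < a) : gammaQ a 0 = 1 := by
  simp [gammaQ_eq_one_sub ha le_rfl]

lemma gammaQ_nonneg {a : ℝ} (ha : 0 < a) {x : ℝ} (hx : 0 ≤ x) : 0 ≤ gammaQ a x := by
  refine mul_nonneg (inv_nonneg.2 (Real.Gamma_pos_of_pos ha).le)
    (setIntegral_nonneg measurableSet_Ioi fun t ht => ?_)
  have : 0 < t := hx.trans_lt ht
  positivity

lemma gammaQ_le_one {a : ℝ} (ha : 0 < a) {x : ℝ} (hx : 0 ≤ x) : gammaQ a x ≤ 1 := by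
  rw [gammaQ_eq_one_sub ha hx, sub_le_self_iff]
  refine mul_nonneg (inv_nonneg.2 (Real.Gamma_pos_of_pos ha).le)
    (intervalIntegral.integral_nonneg hx fun t ht => ?_)
  have := ht.1
  positivity

lemma tendsto_gammaQ_atTop {a : ℝ} (ha : 0 < a) :
    Filter.Tendsto (gammaQ a) Filter.atTop (nhds 0) := by
  have h := intervalIntegral_tendsto_integral_Ioi (0 : ℝ) (integrableOn_gamma_integrand ha)
    Filter.tendsto_id
  have hG : ∫ t in Set.Ioi (0 : ℝ), t ^ (a - 1) * Real.exp (-t) = Real.Gamma a := by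
    rw [Real.Gamma_eq_integral ha]
    simp only [mul_comm]
  rw [hG] at h
  have h2 := (h.const_mul (Real.Gamma a)⁻¹).const_sub 1
  rw [inv_mul_cancel₀ (Real.Gamma_pos_of_pos ha).ne', sub_self] at h2
  refine h2.congr' ?_
  filter_upwards [Filter.eventually_ge_atTop 0] with x hx
  exact (gammaQ_eq_one_sub ha hx).symm

lemma intervalIntegrable_gamma_integrand {a : ℝ} (ha : 0 < a) {x : ℝ} (hx : 0 ≤ x) :
    IntervalIntegrable (fun t : ℝ => t ^ (a - 1) * Real.exp (-t)) volume 0 x :=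
  (intervalIntegrable_iff_integrableOn_Ioc_of_le hx).2
    ((integrableOn_gamma_integrand ha).mono_set Set.Ioc_subset_Ioi_self)

lemma hasDerivAt_gammaQ {a : ℝ} (ha : 0 < a) {x : ℝ} (hx : 0 < x) :
    HasDerivAt (gammaQ a) (-((Real.Gamma a)⁻¹ * (x ^ (a - 1) * Real.exp (-x)))) x := by
  have hm : Measurable fun t : ℝ => t ^ (a - 1) * Real.exp (-t) := by fun_prop
  have hc : ContinuousAt (fun t : ℝ => t ^ (a - 1) * Real.exp (-t)) x :=
    (Real.continuousAt_rpow_const x _ (Or.inl hx.ne')).mul (by fun_prop)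
  have h := intervalIntegral.integral_hasDerivAt_right (intervalIntegrable_gamma_integrand ha hx.le)
    hm.stronglyMeasurable.stronglyMeasurableAtFilter hc
  refine ((h.const_mul (Real.Gamma a)⁻¹).const_sub 1).congr_of_eventuallyEq ?_
  filter_upwards [lt_mem_nhds hx] with y hy
  exact gammaQ_eq_one_sub ha (le_of_lt hy)

lemma continuousOn_gammaQ {a : ℝ} (ha : 0 < a) : ContinuousOn (gammaQ a) (Set.Ici 0) := by
  have hint : ∀ x y : ℝ, 0 ≤ x → 0 ≤ y →
      IntervalIntegrable (fun t : ℝ => t ^ (a - 1) * Real.exp (-t)) volume x y := fun x y hx hy =>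
    (intervalIntegrable_gamma_integrand ha hx).symm.trans (intervalIntegrable_gamma_integrand ha hy)
  intro x hx
  have hx0 : (0 : ℝ) ≤ x := hx
  rcases hx0.eq_or_lt with rfl | hpos
  -- For `a < 1` the integrand is singular at `0`, so the endpoint rests on continuity of the
  -- primitive of an integrable function rather than on a derivative.
  · have hcont : ContinuousOn (fun y => ∫ t in (0 : ℝ)..y, t ^ (a - 1) * Real.exp (-t))
        (Set.uIcc 0 1) := by
      refine intervalIntegral.continuousOn_primitive_interval ?_
      rw [Set.uIcc_of_le zero_le_one, integrableOn_Icc_iff_integrableOn_Ioc]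
      exact (integrableOn_gamma_integrand ha).mono_set Set.Ioc_subset_Ioi_self
    rw [Set.uIcc_of_le zero_le_one] at hcont
    have h0 : ContinuousWithinAt (fun y => 1 - (Real.Gamma a)⁻¹ *
        ∫ t in (0 : ℝ)..y, t ^ (a - 1) * Real.exp (-t)) (Set.Ici 0) 0 := by
      refine continuousWithinAt_const.sub (continuousWithinAt_const.mul ?_)
      exact (hcont 0 (by simp)).mono_of_mem_nhdsWithin
        (Filter.mem_of_superset (Icc_mem_nhdsGE zero_lt_one) subset_rfl)
    refine h0.congr (fun y hy => gammaQ_eq_one_sub ha hy) (gammaQ_eq_one_sub ha le_rfl)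
  · exact (hasDerivAt_gammaQ ha hpos).continuousAt.continuousWithinAt

/-! ### Alzer's inequality -/

lemma kappa_pos (v : ℕ) : 0 < kappa v :=
  Real.rpow_pos_of_pos (by exact_mod_cast v.factorial_pos) _

lemma factorial_mul_kappa_pow {v : ℕ} (hv : 1 ≤ v) : (v.factorial : ℝ) * kappa v ^ v = 1 := by
  have hf : (0 : ℝ) < v.factorial := by exact_mod_cast v.factorial_pos
  have hv' : (v : ℝ) ≠ 0 := by positivity
  rw [kappa, ← Real.rpow_natCast, ← Real.rpow_mul hf.le, neg_mul, one_div,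
    inv_mul_cancel₀ hv', Real.rpow_neg_one, mul_inv_cancel₀ hf.ne']

/-- `log (y / (1 - e^(-y)))` as a function that is continuous at `0`. -/
noncomputable def logRatio (y : ℝ) : ℝ := -Real.log (dslope (fun y => 1 - Real.exp (-y)) 0 y)

lemma hasDerivAt_one_sub_exp_neg (y : ℝ) :
    HasDerivAt (fun y => 1 - Real.exp (-y)) (Real.exp (-y)) y := by
  simpa using ((hasDerivAt_neg y).exp).const_sub 1

lemma logRatio_zero : logRatio 0 = 0 := by
  simp [logRatio, dslope_same, (hasDerivAt_one_sub_exp_neg 0).deriv]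

lemma logRatio_of_pos {y : ℝ} (hy : 0 < y) :
    logRatio y = Real.log y - Real.log (1 - Real.exp (-y)) := by
  have h1 : 0 < 1 - Real.exp (-y) := by simpa using hy
  rw [logRatio, dslope_of_ne _ hy.ne', slope_def_field]
  simp only [neg_zero, Real.exp_zero, sub_self, sub_zero]
  rw [Real.log_div h1.ne' hy.ne']
  ring

lemma continuousOn_logRatio : ContinuousOn logRatio (Set.Ici 0) := by
  have hd : Continuous (dslope (fun y : ℝ => 1 - Real.exp (-y)) 0) := by
    rw [← continuousOn_univ, continuousOn_dslope Filter.univ_mem]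
    exact ⟨by fun_prop, (hasDerivAt_one_sub_exp_neg 0).differentiableAt⟩
  refine ContinuousOn.neg (hd.continuousOn.log fun y hy => ?_)
  have hy0 : (0 : ℝ) ≤ y := hy
  rcases hy0.eq_or_lt with rfl | hpos
  · simp [dslope_same, (hasDerivAt_one_sub_exp_neg 0).deriv]
  · have h1 : 0 < 1 - Real.exp (-y) := by simpa using hpos
    rw [dslope_of_ne _ hpos.ne', slope_def_field]
    simp only [neg_zero, Real.exp_zero, sub_self, sub_zero]
    positivity

/-- The second derivative is nonpositive exactly when `y² e^y ≤ (e^y - 1)²`, and after division by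
`e^y` this is the square of `y ≤ 2 sinh(y/2)`. -/
lemma concaveOn_logRatio : ConcaveOn ℝ (Set.Ici 0) logRatio := by
  refine concaveOn_of_hasDerivWithinAt2_nonpos (convex_Ici 0) continuousOn_logRatio
    (f' := fun y => 1 / y - 1 / (Real.exp y - 1))
    (f'' := fun y => -1 / y ^ 2 + Real.exp y / (Real.exp y - 1) ^ 2) ?_ ?_ ?_
  all_goals
    rw [interior_Ici]
    intro y hy
    have hy : 0 < y := hy
    have he : 0 < Real.exp y - 1 := by simpa using hy
  · have h1 : 0 < 1 - Real.exp (-y) := by simpa using hy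
    have h := (Real.hasDerivAt_log hy.ne').sub ((hasDerivAt_one_sub_exp_neg y).log h1.ne')
    refine HasDerivAt.hasDerivWithinAt ?_
    refine (h.congr_of_eventuallyEq ?_).congr_deriv ?_
    · filter_upwards [lt_mem_nhds hy] with z hz
      exact logRatio_of_pos hz
    · have : Real.exp (-y) / (1 - Real.exp (-y)) = 1 / (Real.exp y - 1) := by
        rw [Real.exp_neg] at h1 ⊢
        have := Real.exp_pos y
        field_simp
      simp only [this, one_div]
  · have h := (hasDerivAt_inv hy.ne').sub (((Real.hasDerivAt_exp y).sub_const 1).inv he.ne')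
    refine HasDerivAt.hasDerivWithinAt ?_
    simp only [one_div]
    refine h.congr_deriv ?_
    ring
  · have hs : y ≤ Real.exp (y / 2) - Real.exp (-(y / 2)) := by
      have := Real.self_le_sinh_iff.2 (half_pos hy).le
      rw [Real.sinh_eq] at this
      linarith
    have hsq : y ^ 2 * Real.exp y ≤ (Real.exp y - 1) ^ 2 := by
      have h1 : Real.exp y - 1 = Real.exp (y / 2) * (Real.exp (y / 2) - Real.exp (-(y / 2))) := by
        rw [mul_sub, ← Real.exp_add, ← Real.exp_add]
        simp
      have h2 : Real.exp y = Real.exp (y / 2) ^ 2 := by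
        rw [← Real.exp_nat_mul]
        congr 1
        push_cast
        ring
      rw [h1, mul_pow, ← h2, mul_comm]
      gcongr
    have : Real.exp y / (Real.exp y - 1) ^ 2 ≤ 1 / y ^ 2 := by
      rw [div_le_div_iff₀ (by positivity) (by positivity)]
      linarith
    have h3 : -1 / y ^ 2 = -(1 / y ^ 2) := by ring
    rw [h3]
    linarith

/-- Chords of a concave function issuing from a fixed point have decreasing slopes; here the fixed
point is the origin, where `logRatio` vanishes. -/
lemma logRatio_div_anti {y z : ℝ} (hy : 0 < y) (hyz : y ≤ z) :
    logRatio z / z ≤ logRatio y / y := by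
  have hz := hy.trans_le hyz
  have h := concaveOn_logRatio.antitoneOn_slope_gt (x := 0) (by simp)
    (a := y) (b := z) ⟨hy.le, hy⟩ ⟨hz.le, hz⟩ hyz
  simpa [slope_def_field, logRatio_zero] using h

lemma alzer_zero {v : ℕ} (hv : 1 ≤ v) : alzer v 0 = 1 := by
  have : v ≠ 0 := by omega
  simp [alzer, this]

lemma tendsto_alzer_atTop (v : ℕ) : Filter.Tendsto (alzer v) Filter.atTop (nhds 0) := by
  have h1 : Filter.Tendsto (fun x : ℝ => Real.exp (-(kappa v * x))) Filter.atTop (nhds 0) :=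
    Real.tendsto_exp_neg_atTop_nhds_zero.comp (Filter.tendsto_id.const_mul_atTop (kappa_pos v))
  have h := ((h1.const_sub 1).pow v).const_sub 1
  rw [sub_zero, one_pow, sub_self] at h
  exact h

lemma continuous_alzer (v : ℕ) : Continuous (alzer v) := by
  unfold alzer
  fun_prop

lemma hasDerivAt_alzer (v : ℕ) (x : ℝ) :
    HasDerivAt (alzer v)
      (-(v * (1 - Real.exp (-(kappa v * x))) ^ (v - 1) * (kappa v * Real.exp (-(kappa v * x))))) x := by
  have h0 : HasDerivAt (fun x => -(kappa v * x)) (-(kappa v)) x := by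
    exact ((hasDerivAt_id x).const_mul (kappa v)).neg.congr_deriv (by simp)
  have h := ((h0.exp.const_sub 1).pow v).const_sub 1
  refine h.congr_deriv ?_
  ring

/-- The sign of the derivative of `alzer v - gammaQ v`. -/
lemma alzer_deriv_key {v : ℕ} (hv : 1 ≤ v) {x : ℝ} (hx : 0 < x) :
    ∃ a b : ℝ, 0 < a ∧ 0 < b ∧
      Real.log a - Real.log b =
        kappa v * x * ((v - 1 : ℕ) * (logRatio (kappa v * x) / (kappa v * x)) + 1 - (kappa v)⁻¹) ∧
      (-(v * (1 - Real.exp (-(kappa v * x))) ^ (v - 1) * (kappa v * Real.exp (-(kappa v * x)))) +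
        (Real.Gamma v)⁻¹ * (x ^ ((v : ℝ) - 1) * Real.exp (-x))) = v * kappa v * (a - b) := by
  obtain ⟨n, rfl⟩ : ∃ n, v = n + 1 := ⟨v - 1, by omega⟩
  have hk := kappa_pos (n + 1)
  have hkf := factorial_mul_kappa_pow hv
  set k := kappa (n + 1) with hkdef
  have hy : 0 < k * x := by positivity
  have h1 : 0 < 1 - Real.exp (-(k * x)) := by simpa using hy
  -- The witnesses are the Gamma density and the derivative of `(1 - e^(-κx))^v`, each divided by `v
  -- κ`. The normalization `v! κ^v = 1` is what makes this prefactor common to both.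
  refine ⟨(k * x) ^ n * Real.exp (-x), (1 - Real.exp (-(k * x))) ^ n * Real.exp (-(k * x)),
    by positivity, by positivity, ?_, ?_⟩
  · rw [Real.log_mul (by positivity) (by positivity), Real.log_mul (by positivity) (by positivity),
      Real.log_pow, Real.log_pow, Real.log_exp, Real.log_exp, logRatio_of_pos hy]
    simp only [Nat.add_sub_cancel]
    field_simp
    ring
  · have hG : Real.Gamma ((n + 1 : ℕ) : ℝ) = n.factorial := by
      push_cast
      exact Real.Gamma_nat_eq_factorial n
    have hinv : (n.factorial : ℝ)⁻¹ = (n + 1) * k ^ (n + 1) := by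
      rw [Nat.factorial_succ] at hkf
      push_cast at hkf
      refine inv_eq_of_mul_eq_one_right ?_
      linarith
    rw [hG, hinv]
    have : ((n + 1 : ℕ) : ℝ) - 1 = n := by push_cast; ring
    rw [this, Real.rpow_natCast, Nat.add_sub_cancel]
    push_cast
    ring

/-- **Alzer's inequality** for integer parameters. -/
theorem gammaQ_le_alzer {v : ℕ} (hv : 1 ≤ v) {x : ℝ} (hx : 0 ≤ x) :
    gammaQ v x ≤ alzer v x := by
  have hv0 : (0 : ℝ) < v := by exact_mod_cast hv
  by_contra! hlt
  let D : ℝ → ℝ := fun x => alzer v x - gammaQ v x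
  let D' : ℝ → ℝ := fun x =>
    -(v * (1 - Real.exp (-(kappa v * x))) ^ (v - 1) * (kappa v * Real.exp (-(kappa v * x)))) +
        (Real.Gamma v)⁻¹ * (x ^ ((v : ℝ) - 1) * Real.exp (-x))
  have hD0 : D 0 = 0 := by simp [D, alzer_zero hv, gammaQ_zero hv0]
  have hDx : D x < 0 := sub_neg.2 hlt
  have hx0 : 0 < x := by
    rcases hx.eq_or_lt with rfl | h
    · simp [hD0] at hDx
    · exact h
  have hder : ∀ y, 0 < y → HasDerivAt D (D' y) y := fun y hy =>
    ((hasDerivAt_alzer v y).sub (hasDerivAt_gammaQ hv0 hy)).congr_deriv (by simp only [D']; ring)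
  have hcont : ContinuousOn D (Set.Ici 0) :=
    (continuous_alzer v).continuousOn.sub (continuousOn_gammaQ hv0)
  -- If `D x < 0`, then `D` descends somewhere before `x`. As it tends to `0` at infinity, it must
  -- also climb somewhere after `x`.
  obtain ⟨y, hy, hDy⟩ := exists_hasDerivAt_eq_slope D D' hx0
    (hcont.mono Set.Icc_subset_Ici_self) fun y hy => hder y hy.1
  have hlim : Filter.Tendsto D Filter.atTop (nhds 0) := by
    simpa using (tendsto_alzer_atTop v).sub (tendsto_gammaQ_atTop hv0)
  obtain ⟨w, hxw, hDw⟩ := ((Filter.eventually_gt_atTop x).and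
    (hlim.eventually (lt_mem_nhds hDx))).exists
  obtain ⟨z, hz, hDz⟩ := exists_hasDerivAt_eq_slope D D' hxw
    (hcont.mono fun t ht => hx.trans ht.1) fun y hy => hder y (hx0.trans hy.1)
  have hDy' : D' y < 0 := by
    rw [hDy, hD0]
    exact div_neg_of_neg_of_pos (by linarith) (by linarith)
  have hDz' : 0 < D' z := by
    rw [hDz]
    exact div_pos (by linarith) (by linarith)
  have hz0 : 0 < z := hx0.trans hz.1
  have hk := kappa_pos v
  obtain ⟨a, b, ha, hb, hab, hDab⟩ := alzer_deriv_key hv hy.1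
  obtain ⟨a', b', ha', hb', hab', hDab'⟩ := alzer_deriv_key hv hz0
  have h1 : a < b := by
    have : v * kappa v * (a - b) < 0 := hDab ▸ hDy'
    have := neg_of_mul_neg_right this (by positivity)
    linarith
  have h2 : b' < a' := by
    have : 0 < v * kappa v * (a' - b') := hDab' ▸ hDz'
    have := pos_of_mul_pos_right this (by positivity)
    linarith
  have h1' := Real.log_lt_log ha h1
  have h2' := Real.log_lt_log hb' h2
  have hy0 : 0 < kappa v * y := mul_pos hk hy.1
  have hz0' : 0 < kappa v * z := mul_pos hk hz0
  -- Once the positive factor `κ y` or `κ z` is removed, the bracket of `alzer_deriv_key` is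
  -- negative at `y` and positive at the later point `z`, although it is nonincreasing.
  have e1 := neg_of_mul_neg_right (hab ▸ sub_neg.2 h1' : _ < (0 : ℝ)) hy0.le
  have e2 := pos_of_mul_pos_right (hab' ▸ sub_pos.2 h2' : (0 : ℝ) < _) hz0'.le
  have hanti := logRatio_div_anti hy0 (mul_le_mul_of_nonneg_left (hy.2.trans hz.1).le hk.le)
  have := mul_le_mul_of_nonneg_left hanti (Nat.cast_nonneg (α := ℝ) (v - 1))
  linarith

lemma alzer_le_one {v : ℕ} {x : ℝ} (hx : 0 ≤ x) : alzer v x ≤ 1 := by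
  have hk := kappa_pos v
  have : 0 ≤ 1 - Real.exp (-(kappa v * x)) := by
    rw [sub_nonneg, Real.exp_le_one_iff]
    nlinarith
  unfold alzer
  have := pow_nonneg this v
  linarith

lemma alzer_nonneg {v : ℕ} {x : ℝ} (hx : 0 ≤ x) : 0 ≤ alzer v x := by
  have hk := kappa_pos v
  have : 0 ≤ 1 - Real.exp (-(kappa v * x)) := by
    rw [sub_nonneg, Real.exp_le_one_iff]
    nlinarith
  unfold alzer
  have := pow_le_one₀ (n := v) this (by linarith [Real.exp_pos (-(kappa v * x))])
  linarith

lemma alzer_sub_gammaQ_le_alzerGap {v : ℕ} (hv : 1 ≤ v) {x : ℝ} (hx : 0 ≤ x) :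
    alzer v x - gammaQ v x ≤ alzerGap v := by
  have hv0 : (0 : ℝ) < v := by exact_mod_cast hv
  refine le_csSup ⟨1, ?_⟩ ⟨x, hx, rfl⟩
  rintro _ ⟨y, hy, rfl⟩
  have h1 := alzer_le_one (v := v) (x := y) hy
  have h2 := gammaQ_nonneg hv0 (x := y) hy
  simp only
  linarith

/-- Binomial theorem, the term `l = 0` cancelling the leading `1`. In this form the expectation of
the bound reduces to Laplace transforms. -/
lemma alzer_eq_sum (v : ℕ) (x : ℝ) :
    alzer v x = ∑ l ∈ Finset.Icc 1 v,
      (v.choose l : ℝ) * (-1) ^ (l + 1) * Real.exp (-(kappa v * l * x)) := by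
  have h : (1 - Real.exp (-(kappa v * x))) ^ v =
      ∑ l ∈ Finset.range (v + 1), (-Real.exp (-(kappa v * x))) ^ l * (v.choose l : ℝ) := by
    rw [sub_eq_neg_add, add_pow]
    simp
  rw [alzer, h, Finset.sum_range_succ', ← Finset.Ico_add_one_right_eq_Icc,
    Finset.sum_Ico_eq_sum_range, Nat.add_sub_cancel]
  simp only [pow_zero, Nat.choose_zero_right, Nat.cast_one, mul_one]
  rw [sub_add_cancel_right, ← Finset.sum_neg_distrib]
  refine Finset.sum_congr rfl fun l _ => ?_
  rw [neg_pow, ← Real.exp_nat_mul, add_comm 1 l]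
  have : ((l + 1 : ℕ) : ℝ) * -(kappa v * x) = -(kappa v * (l + 1 : ℕ) * x) := by ring
  rw [this]
  ring

/-! ### Partial fractions with explicit coefficients -/

section PartialFractions

open Polynomial

variable {F : Type*} [Field F]

/-- The expansion of `(X + a)^(-n)`. -/
noncomputable def invPowSeries (a : F) (n : ℕ) : PowerSeries F :=
  PowerSeries.mk fun k => (-1) ^ k * ((n + k - 1).choose k : F) * (a ^ (n + k))⁻¹

/-- This is the negative binomial series of `(1 - X)^(-n)` rescaled by `-1/a`, because `1 + X/a =
a⁻¹ (X + a)`. -/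
lemma invPowSeries_mul {a : F} (ha : a ≠ 0) (n : ℕ) :
    invPowSeries a n * (PowerSeries.X + PowerSeries.C a) ^ n = 1 := by
  -- For `n = 0` the truncated `n + k - 1` gives `(k - 1).choose k`, which is `0` for `k ≥ 1` and
  -- `1` for `k = 0`: the series is `1`, as it should be.
  rcases n with _ | n
  · ext k
    rcases k with _ | k <;> simp [invPowSeries, PowerSeries.coeff_one]
  have h := congrArg (PowerSeries.rescale (-a⁻¹))
    (PowerSeries.mk_add_choose_mul_one_sub_pow_eq_one F n)
  have h1 : PowerSeries.rescale (-a⁻¹) (1 - PowerSeries.X : PowerSeries F) =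
      PowerSeries.C a⁻¹ * (PowerSeries.X + PowerSeries.C a) := by
    rw [map_sub, map_one, PowerSeries.rescale_X, mul_add, ← map_mul, inv_mul_cancel₀ ha, map_neg,
      map_one]
    ring
  have h2 : invPowSeries a (n + 1) = PowerSeries.C (a⁻¹ ^ (n + 1)) *
      PowerSeries.rescale (-a⁻¹) (PowerSeries.mk fun k => ((n + k).choose n : F)) := by
    ext k
    have hc : (n + 1 + k - 1).choose k = (n + k).choose n := by
      rw [show n + 1 + k - 1 = n + k by omega, Nat.choose_symm_add]
    rw [PowerSeries.coeff_C_mul, PowerSeries.coeff_rescale, invPowSeries, PowerSeries.coeff_mk,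
      PowerSeries.coeff_mk, hc, pow_add, mul_inv, neg_pow a⁻¹, inv_pow, inv_pow]
    ring
  rw [map_mul, map_pow, map_one, h1, mul_pow, ← map_pow] at h
  rw [h2, ← h]
  ring

variable {ι : Type*} [DecidableEq ι] (s : Finset ι) (n : ι → ℕ) (b : ι → F)

/-- The expansion of `x^m / ∏_{j ≠ u} (x + b_j)^(n_j)` at `x = -b_u`. -/
noncomputable def localSeries (m : ℕ) (u : ι) : PowerSeries F :=
  (PowerSeries.X + PowerSeries.C (-b u)) ^ m * ∏ j ∈ s.erase u, invPowSeries (b j - b u) (n j)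

/-- The numerator of `1 / (x + b_u)^v` in the partial fraction expansion of
`x^m / ∏_j (x + b_j)^(n_j)`. -/
noncomputable def pfCoeff (m : ℕ) (u : ι) (v : ℕ) : F :=
  PowerSeries.coeff (n u - v) (localSeries s n b m u)

variable {s n b}

/-- The variable `X` stands for `x + b_u`. The sum over `v` is the local expansion truncated at
order `n_u`, so it agrees with `localSeries` modulo `X^(n_u)`; multiplying by the other denominators
cancels their inverse series. -/
lemma X_pow_dvd_sub_sum_pfCoeff (hb : Set.InjOn b s) (m : ℕ) {u : ι} (hu : u ∈ s) :
    (X : F[X]) ^ n u ∣ (X + C (-b u)) ^ m -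
      (∑ v ∈ Finset.Icc 1 (n u), C (pfCoeff s n b m u v) * X ^ (n u - v)) *
        ∏ j ∈ s.erase u, (X + C (b j - b u)) ^ n j := by
  rw [X_pow_dvd_iff]
  set T : F[X] := ∑ v ∈ Finset.Icc 1 (n u), C (pfCoeff s n b m u v) * X ^ (n u - v) with hT
  have hTE : (PowerSeries.X : PowerSeries F) ^ n u ∣ localSeries s n b m u - (T : PowerSeries F) := by
    rw [PowerSeries.X_pow_dvd_iff]
    intro d hd
    rw [map_sub, Polynomial.coeff_coe, hT, finsetSum_coeff, sub_eq_zero]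
    simp only [coeff_C_mul, coeff_X_pow]
    rw [Finset.sum_eq_single (n u - d)]
    · rw [if_pos (by omega), mul_one, pfCoeff, Nat.sub_sub_self hd.le]
    · intro v hv hne
      rw [Finset.mem_Icc] at hv
      rw [if_neg (by omega), mul_zero]
    · intro h
      exact absurd (Finset.mem_Icc.2 ⟨by omega, by omega⟩) h
  have hden : (∏ j ∈ s.erase u, invPowSeries (b j - b u) (n j)) *
      ((∏ j ∈ s.erase u, (X + C (b j - b u)) ^ n j : F[X]) : PowerSeries F) = 1 := by
    rw [← Polynomial.coeToPowerSeries.ringHom_apply, map_prod, ← Finset.prod_mul_distrib]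
    refine Finset.prod_eq_one fun j hj => ?_
    rw [Finset.mem_erase] at hj
    have : b j - b u ≠ 0 := sub_ne_zero.2 fun h => hj.1 (hb hj.2 hu h)
    simpa using invPowSeries_mul this (n j)
  have hdvd := hTE.mul_right ((∏ j ∈ s.erase u, (X + C (b j - b u)) ^ n j : F[X]) : PowerSeries F)
  rw [sub_mul, localSeries, mul_assoc, hden, mul_one, PowerSeries.X_pow_dvd_iff] at hdvd
  intro d hd
  rw [← Polynomial.coeff_coe, ← hdvd d hd]
  congr 1
  rw [← Polynomial.coeToPowerSeries.ringHom_apply]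
  simp

lemma X_add_C_pow_dvd_sub_sum_pfCoeff (hb : Set.InjOn b s) (m : ℕ) {u : ι} (hu : u ∈ s) :
    (X + C (b u) : F[X]) ^ n u ∣ X ^ m -
      (∑ v ∈ Finset.Icc 1 (n u), C (pfCoeff s n b m u v) * (X + C (b u)) ^ (n u - v)) *
        ∏ j ∈ s.erase u, (X + C (b j)) ^ n j := by
  have h := map_dvd (compRingHom (X + C (b u))) (X_pow_dvd_sub_sum_pfCoeff (n := n) hb m hu)
  have hx : (X + C (b u) + C (-b u) : F[X]) = X := by simp
  have hj : ∀ j, (X + C (b u) + (C (b j - b u)) : F[X]) = X + C (b j) := by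
    intro j
    rw [add_assoc, ← C_add, add_sub_cancel]
  simpa [map_sum, map_prod, Polynomial.prod_comp, hj,
    coe_compRingHom] using h

/-- The difference of the two sides is divisible by every `(X + b_u)^(n_u)`: the `u`-th summand by
the local expansion, the others because they contain this factor. These powers are pairwise coprime,
so their product divides the difference, whose degree is smaller than that of the product. -/
theorem X_pow_eq_sum_pfCoeff (hb : Set.InjOn b s) {m : ℕ} (hm : m < ∑ j ∈ s, n j) :
    (X : F[X]) ^ m = ∑ u ∈ s,
      (∑ v ∈ Finset.Icc 1 (n u), C (pfCoeff s n b m u v) * (X + C (b u)) ^ (n u - v)) *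
        ∏ j ∈ s.erase u, (X + C (b j)) ^ n j := by
  rw [← sub_eq_zero]
  have hdeg : (∏ j ∈ s, (X + C (b j)) ^ n j : F[X]).degree = (∑ j ∈ s, n j : ℕ) := by
    rw [degree_prod]
    simp
  refine eq_zero_of_dvd_of_degree_lt (p := ∏ j ∈ s, (X + C (b j)) ^ n j) ?_ ?_
  · refine Finset.prod_dvd_of_coprime ?_ ?_
    · intro i hi j hj hij
      refine IsCoprime.pow ?_
      have : b i ≠ b j := fun h => hij (hb hi hj h)
      have h := pairwise_coprime_X_sub_C (Function.injective_id (α := F))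
        (i := -b i) (j := -b j) (by simpa using this)
      simpa [Function.onFun] using h
    · intro u hu
      rw [← Finset.add_sum_erase _ _ hu, ← sub_sub]
      refine dvd_sub (X_add_C_pow_dvd_sub_sum_pfCoeff hb m hu) (Finset.dvd_sum fun w hw => ?_)
      refine Dvd.dvd.mul_left (Finset.dvd_prod_of_mem (fun j => (X + C (b j) : F[X]) ^ n j) ?_) _
      rw [Finset.mem_erase] at hw ⊢
      exact ⟨hw.1.symm, hu⟩
  · rw [hdeg]
    refine (degree_sub_le _ _).trans_lt (max_lt ?_ ?_)
    · rw [degree_X_pow]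
      exact_mod_cast hm
    · refine (degree_sum_le _ _).trans_lt ((Finset.sup_lt_iff (WithBot.bot_lt_coe _)).2 fun u hu => ?_)
      rw [← Finset.add_sum_erase _ _ hu, degree_mul]
      have h1 : (∏ j ∈ s.erase u, (X + C (b j)) ^ n j : F[X]).degree =
          (∑ j ∈ s.erase u, n j : ℕ) := by
        rw [degree_prod]
        simp
      rw [h1, Nat.cast_add]
      refine WithBot.add_lt_add_right (by exact_mod_cast WithBot.coe_ne_bot) ?_
      refine (degree_sum_le _ _).trans_lt ((Finset.sup_lt_iff (WithBot.bot_lt_coe _)).2 fun v hv => ?_)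
      rw [Finset.mem_Icc] at hv
      rw [← smul_eq_C_mul]
      refine (degree_smul_le _ _).trans_lt ?_
      rw [degree_pow, degree_X_add_C]
      simp only [nsmul_eq_mul, mul_one]
      exact_mod_cast (by omega : n u - v < n u)

/-- The extension `L` lets real coefficients be used at a complex point. -/
theorem pow_div_prod_eq_sum_pfCoeff {L : Type*} [Field L] [Algebra F L] (hb : Set.InjOn b s) {m : ℕ}
    (hm : m < ∑ j ∈ s, n j) {z : L} (hz : ∀ j ∈ s, z + algebraMap F L (b j) ≠ 0) :
    z ^ m / ∏ j ∈ s, (z + algebraMap F L (b j)) ^ n j =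
      ∑ u ∈ s, ∑ v ∈ Finset.Icc 1 (n u),
        algebraMap F L (pfCoeff s n b m u v) / (z + algebraMap F L (b u)) ^ v := by
  have h := congrArg (aeval z) (X_pow_eq_sum_pfCoeff hb hm)
  simp only [map_pow, aeval_X, map_sum, map_mul, map_prod, map_add, aeval_C] at h
  rw [h, Finset.sum_div]
  refine Finset.sum_congr rfl fun u hu => ?_
  rw [Finset.sum_mul, Finset.sum_div]
  refine Finset.sum_congr rfl fun v hv => ?_
  rw [Finset.mem_Icc] at hv
  have hu0 := hz u hu
  have hp : ∏ j ∈ s.erase u, (z + algebraMap F L (b j)) ^ n j ≠ 0 :=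
    Finset.prod_ne_zero_iff.2 fun j hj => pow_ne_zero _ (hz j (Finset.mem_of_mem_erase hj))
  rw [← Finset.mul_prod_erase _ _ hu, mul_div_mul_right _ _ hp, div_eq_div_iff (by positivity)
    (by positivity), mul_assoc, ← pow_add, Nat.sub_add_cancel hv.2]

lemma pfCoeff_eq_sum (m : ℕ) {u : ι} (hu : u ∈ s) (v : ℕ) :
    pfCoeff s n b m u v = ∑ k ∈ Finset.piAntidiag s (n u - v),
      ((-b u) ^ (m - k u) * (m.choose (k u) : F)) * ∏ j ∈ s.erase u,
        ((-1) ^ k j * ((n j + k j - 1).choose (k j) : F) * ((b j - b u) ^ (n j + k j))⁻¹) := by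
  -- The power of `X - b_u` takes the vacant place `u`, so that the coefficient of the product
  -- becomes one sum over families indexed by all of `s`.
  have hf : localSeries s n b m u = ∏ j ∈ s, if j = u then
      (PowerSeries.X + PowerSeries.C (-b u)) ^ m else invPowSeries (b j - b u) (n j) := by
    rw [← Finset.mul_prod_erase _ _ hu, if_pos rfl, localSeries]
    congr 1
    exact Finset.prod_congr rfl fun j hj => (if_neg (Finset.ne_of_mem_erase hj)).symm
  have hX : ∀ k, PowerSeries.coeff k ((PowerSeries.X + PowerSeries.C (-b u)) ^ m) =
      (-b u) ^ (m - k) * (m.choose k : F) := by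
    intro k
    rw [← Polynomial.coeff_X_add_C_pow, ← Polynomial.coeff_coe,
      ← Polynomial.coeToPowerSeries.ringHom_apply]
    simp
  rw [pfCoeff, hf, PowerSeries.coeff_prod]
  refine Finset.sum_bij' (fun l _ => (l : ι → ℕ))
    (fun k hk => Finsupp.onFinset s k (Finset.mem_piAntidiag.1 hk).2) ?_ ?_ ?_ ?_ ?_
  · intro l hl
    rw [Finset.mem_finsuppAntidiag] at hl
    rw [Finset.mem_piAntidiag]
    exact ⟨hl.1, fun i hi => hl.2 (Finsupp.mem_support_iff.2 hi)⟩
  · intro k hk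
    rw [Finset.mem_piAntidiag] at hk
    rw [Finset.mem_finsuppAntidiag]
    exact ⟨hk.1, Finsupp.support_onFinset_subset⟩
  · intro l hl
    ext; rfl
  · intro k hk
    rfl
  · intro l hl
    rw [← Finset.mul_prod_erase _ _ hu, if_pos rfl, hX]
    congr 1
    refine Finset.prod_congr rfl fun j hj => ?_
    rw [if_neg (Finset.ne_of_mem_erase hj), invPowSeries, PowerSeries.coeff_mk]

end PartialFractions

/-! ### The coefficients of the network -/

namespace Params

variable {K M : ℕ} (N : Params K M)

lemma dK_pos : 0 < N.dK := N.d_pos _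

lemma nd_pos (i : Fin K) : 0 < N.nd i := div_pos (N.d_pos i) N.dK_pos

lemma η_pos : 0 < N.η := by linarith [N.η_gt]

lemma pos_of_mem_deltas {δ : ℝ} (hδ : δ ∈ N.deltas) : 0 < δ := by
  obtain ⟨i, -, rfl⟩ := Finset.mem_image.1 hδ
  exact N.nd_pos i

lemma injOn_rpow_deltas : Set.InjOn (fun δ : ℝ => δ ^ N.η) N.deltas := fun _ hx _ hy h =>
  (Real.rpow_left_inj (N.pos_of_mem_deltas hx).le (N.pos_of_mem_deltas hy).le N.η_pos.ne').1 h

lemma prod_deltas_pow_mult {L : Type*} [CommMonoid L] (f : ℝ → L) :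
    ∏ δ ∈ N.deltas, f δ ^ N.mult δ = ∏ i, f (N.nd i) := by
  simp only [mult]
  exact (Finset.prod_comp f N.nd).symm

lemma sum_mult : ∑ δ ∈ N.deltas, N.mult δ = K := by
  have h : ∑ δ ∈ N.deltas, N.mult δ = (Finset.univ : Finset (Fin K)).card :=
    (Finset.card_eq_sum_card_image N.nd Finset.univ).symm
  simpa using h

/-- The signs `(-1)^(m - k_u)` and `(-1)^(k_j)` combine to `(-1)^m (-1)^(n_u - v)` because the `k_j`
add up to `n_u - v`. The factor `(δ^η)^v` is split off since it is the numerator of a Gamma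
characteristic function. -/
lemma pfCoeff_eq_A (m : ℕ) {δ : ℝ} (hδ : δ ∈ N.deltas) (v : ℕ) :
    pfCoeff N.deltas N.mult (fun δ => δ ^ N.η) m δ v =
      (-1) ^ m * (δ ^ N.η) ^ v * N.A m δ v := by
  have hpos := N.pos_of_mem_deltas hδ
  have hcancel : (δ ^ N.η) ^ v * δ ^ (-(v * N.η)) = 1 := by
    rw [← Real.rpow_mul_natCast hpos.le, ← Real.rpow_add hpos]
    ring_nf
    simp
  have hA : (-1) ^ m * (δ ^ N.η) ^ v * N.A m δ v = (-1) ^ m * ((-1) ^ (N.mult δ - v) *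
    ∑ k ∈ Finset.piAntidiag N.deltas (N.mult δ - v),
      (m.choose (k δ) : ℝ) * δ ^ (N.η * ((m : ℝ) - (k δ : ℝ))) *
        ∏ ε ∈ N.deltas.erase δ,
          ((N.mult ε + k ε - 1).choose (k ε) : ℝ) *
            ((ε ^ N.η - δ ^ N.η) ^ (N.mult ε + k ε))⁻¹) := by
    rw [A]
    linear_combination ((-1) ^ m * ((-1) ^ (N.mult δ - v) *
      ∑ k ∈ Finset.piAntidiag N.deltas (N.mult δ - v),
        (m.choose (k δ) : ℝ) * δ ^ (N.η * ((m : ℝ) - (k δ : ℝ))) *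
          ∏ ε ∈ N.deltas.erase δ,
            ((N.mult ε + k ε - 1).choose (k ε) : ℝ) *
              ((ε ^ N.η - δ ^ N.η) ^ (N.mult ε + k ε))⁻¹)) * hcancel
  rw [hA, pfCoeff_eq_sum m hδ, Finset.mul_sum, Finset.mul_sum]
  refine Finset.sum_congr rfl fun k hk => ?_
  rw [Finset.mem_piAntidiag] at hk
  -- The real exponent `m - k_u` and the truncated natural one differ when `m < k_u`, but then the
  -- binomial coefficient vanishes.
  rcases lt_or_ge m (k δ) with hlt | hle
  · simp [Nat.choose_eq_zero_of_lt hlt]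
  · have hprod : ∏ j ∈ N.deltas.erase δ, ((-1 : ℝ) ^ k j * ((N.mult j + k j - 1).choose (k j) : ℝ) *
        ((j ^ N.η - δ ^ N.η) ^ (N.mult j + k j))⁻¹) =
        (-1) ^ (∑ j ∈ N.deltas.erase δ, k j) * ∏ ε ∈ N.deltas.erase δ,
          ((N.mult ε + k ε - 1).choose (k ε) : ℝ) *
            ((ε ^ N.η - δ ^ N.η) ^ (N.mult ε + k ε))⁻¹ := by
      rw [← Finset.prod_pow_eq_pow_sum, ← Finset.prod_mul_distrib]
      exact Finset.prod_congr rfl fun j _ => by ring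
    have hsum : k δ + ∑ j ∈ N.deltas.erase δ, k j = N.mult δ - v := by
      rw [Finset.add_sum_erase _ _ hδ, hk.1]
    have hpow : δ ^ (N.η * ((m : ℝ) - (k δ : ℝ))) = (δ ^ N.η) ^ (m - k δ) := by
      rw [Real.rpow_mul hpos.le, ← Nat.cast_sub hle, Real.rpow_natCast]
    have hsign : (-1 : ℝ) ^ (m - k δ) * (-1) ^ (∑ j ∈ N.deltas.erase δ, k j) =
        (-1) ^ m * (-1) ^ (N.mult δ - v) := by
      rw [← hsum, ← pow_add, ← pow_add]
      refine neg_one_pow_congr ?_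
      obtain ⟨r, rfl⟩ := Nat.exists_eq_add_of_le hle
      rw [Nat.add_sub_cancel_left]
      simp only [Nat.even_add]
      tauto
    rw [hprod, hpow, neg_pow]
    linear_combination ((δ ^ N.η) ^ (m - k δ) * (m.choose (k δ) : ℝ) *
      ∏ ε ∈ N.deltas.erase δ,
          ((N.mult ε + k ε - 1).choose (k ε) : ℝ) *
            ((ε ^ N.η - δ ^ N.η) ^ (N.mult ε + k ε))⁻¹) * hsign

lemma prod_add_eq_sum_esymm (z : ℂ) (a : Fin K → ℝ) :
    ∏ i, (z + a i) =
      ∑ m ∈ Finset.range (K + 1), (((Finset.univ.val.map a).esymm (K - m) : ℝ) : ℂ) * z ^ m := by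
  have h := Multiset.prod_X_add_C_eq_sum_esymm (Finset.univ.val.map a)
  have h2 := congrArg (Polynomial.aeval z) h
  simp only [Multiset.map_map, Multiset.card_map, Finset.card_val, Finset.card_univ,
    Fintype.card_fin, map_sum, map_mul, Polynomial.aeval_C, map_pow, Polynomial.aeval_X,
    Complex.coe_algebraMap] at h2
  have h3 : (Multiset.map ((fun r => Polynomial.X + Polynomial.C r) ∘ a)
      (Finset.univ : Finset (Fin K)).val).prod = ∏ i, (Polynomial.X + Polynomial.C (a i)) := rfl
  rw [h3, map_prod] at h2
  simp only [map_add, Polynomial.aeval_X, Polynomial.aeval_C, Complex.coe_algebraMap] at h2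
  rw [h2, ← Finset.sum_range_reflect]
  refine Finset.sum_congr rfl fun m hm => ?_
  rw [Finset.mem_range] at hm
  rw [show K + 1 - 1 - m = K - m by omega, show K - (K - m) = m by omega]

/-- Both products are monic of degree `K` in `z`, so their difference has degree below `K` and its
coefficients are differences of elementary symmetric polynomials. The sign `(-1)^m` in `alpha`
cancels the one in `pfCoeff_eq_A`. -/
theorem prod_div_prod_eq {z : ℂ} (hz : ∀ i, z + (N.nd i ^ N.η : ℝ) ≠ 0) :
    ∏ i, (z + (N.nd i ^ N.η / N.q i : ℝ)) / (z + (N.nd i ^ N.η : ℝ)) =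
      1 + ∑ δ ∈ N.deltas, ∑ v ∈ Finset.Icc 1 (N.mult δ),
        (N.coeff δ v : ℂ) * (((δ ^ N.η : ℝ) : ℂ) / (z + (δ ^ N.η : ℝ))) ^ v := by
  have hz' : ∀ δ ∈ N.deltas, z + algebraMap ℝ ℂ (δ ^ N.η) ≠ 0 := by
    intro δ hδ
    obtain ⟨i, -, rfl⟩ := Finset.mem_image.1 hδ
    exact hz i
  have hden : ∏ i, (z + (N.nd i ^ N.η : ℝ)) ≠ 0 := Finset.prod_ne_zero_iff.2 fun i _ => hz i
  have hden' : ∏ δ ∈ N.deltas, (z + algebraMap ℝ ℂ (δ ^ N.η)) ^ N.mult δ =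
      ∏ i, (z + (N.nd i ^ N.η : ℝ)) :=
    N.prod_deltas_pow_mult fun δ => z + algebraMap ℝ ℂ (δ ^ N.η)
  have hdiff : ∏ i, (z + (N.nd i ^ N.η / N.q i : ℝ)) = ∏ i, (z + (N.nd i ^ N.η : ℝ)) +
      ∑ m ∈ Finset.range K,
        ((N.OmHat.esymm (K - m) - N.Om.esymm (K - m) : ℝ) : ℂ) * z ^ m := by
    rw [prod_add_eq_sum_esymm, prod_add_eq_sum_esymm, Finset.sum_range_succ, Finset.sum_range_succ]
    have h0 : ∀ S : Multiset ℝ, S.esymm 0 = 1 := fun S => by simp [Multiset.esymm]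
    simp only [Nat.sub_self, h0, OmHat, Om, Complex.ofReal_sub, sub_mul,
      Finset.sum_sub_distrib]
    ring
  rw [Finset.prod_div_distrib, hdiff, add_div, div_self hden, Finset.sum_div]
  congr 1
  have hterm : ∀ m ∈ Finset.range K, ((N.OmHat.esymm (K - m) - N.Om.esymm (K - m) : ℝ) : ℂ) * z ^ m /
      ∏ i, (z + (N.nd i ^ N.η : ℝ)) = ∑ δ ∈ N.deltas, ∑ v ∈ Finset.Icc 1 (N.mult δ),
        (((N.alpha N.OmHat m - N.alpha N.Om m) * N.A m δ v : ℝ) : ℂ) *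
          (((δ ^ N.η : ℝ) : ℂ) / (z + (δ ^ N.η : ℝ))) ^ v := by
    intro m hm
    rw [Finset.mem_range] at hm
    rw [mul_div_assoc, ← hden', pow_div_prod_eq_sum_pfCoeff N.injOn_rpow_deltas
      (by rwa [N.sum_mult]) hz', Finset.mul_sum]
    refine Finset.sum_congr rfl fun δ hδ => ?_
    rw [Finset.mul_sum]
    refine Finset.sum_congr rfl fun v _ => ?_
    rw [N.pfCoeff_eq_A m hδ v, div_pow, alpha, alpha]
    simp only [Complex.coe_algebraMap]
    push_cast
    ring
  rw [Finset.sum_congr rfl hterm, Finset.sum_comm]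
  refine Finset.sum_congr rfl fun δ _ => ?_
  rw [Finset.sum_comm]
  refine Finset.sum_congr rfl fun v _ => ?_
  rw [coeff, Complex.ofReal_sum, Finset.sum_mul]

end Params

/-! ### Independence in the network model -/

section Independence

variable {Ω : Type*} {K M : ℕ}

/-- The σ-algebra generated by a set of sources of randomness. -/
@[reducible] def Vars.alg (W : Vars Ω K M) (S : Set (Source K M)) : MeasurableSpace Ω :=
  ⨆ s ∈ S, W.sigmaAlg s

lemma Vars.sigmaAlg_le_alg (W : Vars Ω K M) {S : Set (Source K M)} {s : Source K M} (hs : s ∈ S) :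
    W.sigmaAlg s ≤ W.alg S :=
  le_iSup₂ (f := fun s (_ : s ∈ S) => W.sigmaAlg s) s hs

lemma Vars.alg_mono (W : Vars Ω K M) {S T : Set (Source K M)} (h : S ⊆ T) : W.alg S ≤ W.alg T :=
  biSup_mono h

lemma Vars.measurable_on (W : Vars Ω K M) {S : Set (Source K M)} {i : Fin K}
    (h : Source.on i ∈ S) : Measurable[W.alg S] (W.on i) :=
  Measurable.of_comap_le (W.sigmaAlg_le_alg h)

lemma Vars.measurable_H (W : Vars Ω K M) {S : Set (Source K M)} {i : Fin K}
    (h : Source.H i ∈ S) : Measurable[W.alg S] (W.H i) :=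
  Measurable.of_comap_le (W.sigmaAlg_le_alg h)

lemma Vars.measurable_onI (W : Vars Ω K M) {S : Set (Source K M)} {m : Fin (M + 1)} {i : ℕ}
    (h : Source.onI m i ∈ S) : Measurable[W.alg S] (W.onI m i) :=
  Measurable.of_comap_le (W.sigmaAlg_le_alg h)

lemma Vars.measurable_HI (W : Vars Ω K M) {S : Set (Source K M)} {m : Fin (M + 1)} {i : ℕ}
    (h : Source.HI m i ∈ S) : Measurable[W.alg S] (W.HI m i) :=
  Measurable.of_comap_le (W.sigmaAlg_le_alg h)

lemma Vars.measurable_X (W : Vars Ω K M) {S : Set (Source K M)} {m : Fin (M + 1)}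
    (h : Source.X m ∈ S) (i : ℕ) : Measurable[W.alg S] (W.X m i) :=
  Measurable.of_comap_le
    ((le_iSup (fun i => MeasurableSpace.comap (W.X m i) inferInstance) i).trans
      (W.sigmaAlg_le_alg h))

lemma Vars.measurable_ite_on (W : Vars Ω K M) {S : Set (Source K M)} {i : Fin K}
    (h : Source.on i ∈ S) (h' : Source.H i ∈ S) {β : Type*} [MeasurableSpace β] {f : ℝ → β}
    (hf : Measurable f) (c : β) :
    Measurable[W.alg S] fun ω => if W.on i ω then f (W.H i ω) else c :=
  Measurable.ite (W.measurable_on h (measurableSet_singleton true))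
    (hf.comp (W.measurable_H h')) measurable_const

lemma Vars.measurable_normSignal {N : Params K M} (W : Vars Ω K M) {S : Set (Source K M)}
    (h : ∀ i, Source.on i ∈ S) (h' : ∀ i, Source.H i ∈ S) : Measurable[W.alg S] (N.normSignal W) :=
  Finset.measurable_fun_sum _ fun i _ => W.measurable_ite_on (h i) (h' i)
    (f := fun h => N.nd i ^ (-N.η) * h) (by fun_prop) 0

variable [MeasurableSpace Ω] {N : Params K M} {W : Vars Ω K M} {μ : Measure Ω}

lemma IsModel.sigmaAlg_le (hW : IsModel N W μ) (s : Source K M) :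
    W.sigmaAlg s ≤ ‹MeasurableSpace Ω› := by
  cases s with
  | on i => exact (hW.meas_on i).comap_le
  | H i => exact (hW.meas_H i).comap_le
  | X m => exact iSup_le fun i => ((hW.poisson m).measurable i).comap_le
  | onI m i => exact (hW.meas_onI m i).comap_le
  | HI m i => exact (hW.meas_HI m i).comap_le

lemma IsModel.alg_le (hW : IsModel N W μ) (S : Set (Source K M)) :
    W.alg S ≤ ‹MeasurableSpace Ω› :=
  iSup₂_le fun s _ => hW.sigmaAlg_le s

lemma IsModel.indep_alg (hW : IsModel N W μ) {S T : Set (Source K M)} (hST : Disjoint S T) :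
    Indep (W.alg S) (W.alg T) μ :=
  indep_iSup_of_disjoint hW.sigmaAlg_le hW.indep hST

lemma IsModel.indepFun (hW : IsModel N W μ) {S T : Set (Source K M)} (hST : Disjoint S T)
    {α β : Type*} {mα : MeasurableSpace α} {mβ : MeasurableSpace β} {f : Ω → α} {g : Ω → β}
    (hf : Measurable[W.alg S] f) (hg : Measurable[W.alg T] g) : IndepFun f g μ := by
  rw [IndepFun_iff_Indep]
  exact indep_of_indep_of_le (hW.indep_alg hST) hf.comap_le hg.comap_le

lemma IsModel.measurable_normSignal (hW : IsModel N W μ) : Measurable (N.normSignal W) :=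
  (W.measurable_normSignal (S := Set.univ) (fun _ => trivial) fun _ => trivial).mono
    (hW.alg_le _) le_rfl

end Independence

/-! ### Gated random variables -/

section Gate

variable {Ω : Type*} [MeasurableSpace Ω] {μ : Measure Ω} [IsProbabilityMeasure μ]

lemma prob_eq_false {b : Ω → Bool} (hb : Measurable b) {p : ℝ}
    (hp : μ.real {ω | b ω = true} = p) : μ.real {ω | b ω = false} = 1 - p := by
  have hm : MeasurableSet {ω | b ω = true} := hb (measurableSet_singleton true)
  have h := probReal_compl_eq_one_sub (μ := μ) hm
  rw [hp] at h
  rw [← h]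
  congr 1
  ext ω
  simp

/-- The integrand is the indicator of a closed gate plus the indicator of an open gate times `f(Z)`,
and independence factors the second term. The value `1` of a closed gate is the exponential of a
zero contribution. -/
lemma integral_gate {b : Ω → Bool} (hb : Measurable b) {α : Type*} [MeasurableSpace α] {Z : Ω → α}
    (hZ : Measurable Z) (hbZ : IndepFun b Z μ) {p : ℝ} (hp : μ.real {ω | b ω = true} = p)
    {f : α → ℂ} (hf : Measurable f) (hint : Integrable (fun ω => f (Z ω)) μ) :
    ∫ ω, (if b ω then f (Z ω) else 1) ∂μ = (1 - p : ℝ) + p * ∫ ω, f (Z ω) ∂μ := by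
  have hm : MeasurableSet {ω | b ω = true} := hb (measurableSet_singleton true)
  have hm' : MeasurableSet {ω | b ω = false} := hb (measurableSet_singleton false)
  have hsplit : ∀ ω, (if b ω then f (Z ω) else 1) =
      {ω | b ω = false}.indicator (fun _ => (1 : ℂ)) ω + (fun c : Bool => if c then (1 : ℂ) else 0) (b ω) * f (Z ω) := by
    intro ω
    cases h : b ω <;> simp [Set.indicator, h]
  have hcont : Measurable fun c : Bool => if c then (1 : ℂ) else 0 := measurable_of_finite _
  have hind : ∫ ω, (fun c : Bool => if c then (1 : ℂ) else 0) (b ω) ∂μ = p := by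
    have : (fun ω => (fun c : Bool => if c then (1 : ℂ) else 0) (b ω)) =
        {ω | b ω = true}.indicator fun _ => (1 : ℂ) := by
      ext ω
      simp [Set.indicator]
    rw [this, integral_indicator_const _ hm, hp]
    simp
  simp_rw [hsplit]
  rw [integral_add, integral_indicator_const _ hm', prob_eq_false hb hp,
    hbZ.integral_fun_comp_mul_comp hb.aemeasurable hZ.aemeasurable hcont.aestronglyMeasurable
      hf.aestronglyMeasurable, hind]
  · simp
  · exact (integrable_const _).indicator hm'
  · refine hint.bdd_mul (c := 1) (hcont.comp hb).aestronglyMeasurable (ae_of_all _ fun ω => ?_)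
    cases b ω <;> simp

lemma lintegral_gate {b : Ω → Bool} (hb : Measurable b) {α : Type*} [MeasurableSpace α] {Z : Ω → α}
    (hZ : Measurable Z) (hbZ : IndepFun b Z μ) {p : ℝ} (hp : μ.real {ω | b ω = true} = p)
    {f : α → ℝ≥0∞} (hf : Measurable f) :
    ∫⁻ ω, (if b ω then f (Z ω) else 1) ∂μ =
      ENNReal.ofReal (1 - p) + ENNReal.ofReal p * ∫⁻ ω, f (Z ω) ∂μ := by
  have hm : MeasurableSet {ω | b ω = true} := hb (measurableSet_singleton true)
  have hm' : MeasurableSet {ω | b ω = false} := hb (measurableSet_singleton false)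
  have hsplit : ∀ ω, (if b ω then f (Z ω) else 1) =
      {ω | b ω = false}.indicator (fun _ => (1 : ℝ≥0∞)) ω +
        (fun c : Bool => if c then (1 : ℝ≥0∞) else 0) (b ω) * f (Z ω) := by
    intro ω
    cases h : b ω <;> simp [Set.indicator, h]
  have hcont : Measurable fun c : Bool => if c then (1 : ℝ≥0∞) else 0 := measurable_of_finite _
  have hind : ∫⁻ ω, (fun c : Bool => if c then (1 : ℝ≥0∞) else 0) (b ω) ∂μ = ENNReal.ofReal p := by
    have : (fun ω => (fun c : Bool => if c then (1 : ℝ≥0∞) else 0) (b ω)) =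
        {ω | b ω = true}.indicator fun _ => (1 : ℝ≥0∞) := by
      ext ω
      simp [Set.indicator]
    rw [this, lintegral_indicator_const hm, one_mul, ← hp, ofReal_measureReal]
  simp_rw [hsplit]
  rw [lintegral_add_left (measurable_const.indicator hm'), lintegral_indicator_const hm', one_mul,
    ← ofReal_measureReal, prob_eq_false hb hp,
    ← hind]
  congr 1
  exact lintegral_mul_eq_lintegral_mul_lintegral_of_indepFun'' (hcont.comp hb).aemeasurable
      (hf.comp hZ).aemeasurable (hbZ.comp hcont hf)

end Gate

/-! ### Gamma distributions and signed mixtures -/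

lemma gammaMeasure_real_Ioi {a b : ℝ} (ha : 0 < a) (hb : 0 < b) {x : ℝ} (hx : 0 ≤ x) :
    (gammaMeasure a b).real (Set.Ioi x) = gammaQ a (b * x) := by
  have h1 : (gammaMeasure a b).real (Set.Ioi x) = ∫ y in Set.Ioi x, gammaPDFReal a b y := by
    rw [measureReal_def, gammaMeasure, withDensity_apply _ measurableSet_Ioi,
      integral_eq_lintegral_of_nonneg_ae (ae_of_all _ fun y => gammaPDFReal_nonneg ha hb y)
        (measurable_gammaPDFReal a b).aestronglyMeasurable]
    rfl
  have h2 := integral_comp_mul_left_Ioi (fun t : ℝ => t ^ (a - 1) * Real.exp (-t)) x hb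
  have h3 : ∫ y in Set.Ioi x, gammaPDFReal a b y = ∫ y in Set.Ioi x,
      (b * (Real.Gamma a)⁻¹) * ((b * y) ^ (a - 1) * Real.exp (-(b * y))) := by
    refine setIntegral_congr_fun measurableSet_Ioi fun y hy => ?_
    have hy0 : 0 < y := hx.trans_lt hy
    simp only [gammaPDFReal, if_pos hy0.le]
    rw [Real.mul_rpow hb.le hy0.le, Real.rpow_sub_one hb.ne']
    field_simp
  rw [h1, h3, integral_const_mul, h2, gammaQ, smul_eq_mul]
  field_simp

lemma integrableOn_pow_mul_cexp (n : ℕ) {r : ℂ} (hr : 0 < r.re) :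
    IntegrableOn (fun x : ℝ => (x : ℂ) ^ n * Complex.exp (-r * x)) (Set.Ioi 0) := by
  have h := integrableOn_rpow_mul_exp_neg_mul_rpow (p := 1) (s := n) (b := r.re)
    (by linarith [n.cast_nonneg (α := ℝ)]) one_pos hr
  refine Integrable.mono' h (by fun_prop) ?_
  filter_upwards [ae_restrict_mem measurableSet_Ioi] with x hx
  have hx : 0 < x := hx
  rw [norm_mul, norm_pow, Complex.norm_exp, Complex.norm_real, Real.norm_of_nonneg hx.le]
  simp

/-- Integration by parts: `x^(n+1) e^(-rx)` vanishes at both ends, so the integral of its derivative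
is zero, which relates the exponents `n` and `n + 1`. -/
lemma integral_pow_mul_cexp (n : ℕ) {r : ℂ} (hr : 0 < r.re) :
    ∫ x in Set.Ioi (0 : ℝ), (x : ℂ) ^ n * Complex.exp (-r * x) = n.factorial / r ^ (n + 1) := by
  have hr0 : r ≠ 0 := fun h => by simp [h] at hr
  induction n with
  | zero =>
    have h := integral_exp_mul_complex_Ioi (a := -r) (by simpa using hr) 0
    simp only [pow_zero, one_mul, h]
    simp
  | succ n ih =>
    have hd : ∀ x ∈ Set.Ici (0 : ℝ), HasDerivAt
        (fun x : ℝ => (x : ℂ) ^ (n + 1) * Complex.exp (-r * x))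
        ((n + 1) * ((x : ℂ) ^ n * Complex.exp (-r * x)) -
          r * ((x : ℂ) ^ (n + 1) * Complex.exp (-r * x))) x := by
      intro x _
      have h1 : HasDerivAt (fun z : ℂ => z ^ (n + 1) * Complex.exp (-r * z))
          ((n + 1) * ((x : ℂ) ^ n * Complex.exp (-r * x)) -
          r * ((x : ℂ) ^ (n + 1) * Complex.exp (-r * x))) (x : ℂ) := by
        have h2 := (hasDerivAt_pow (n + 1) (x : ℂ)).mul
          (((hasDerivAt_id (x : ℂ)).const_mul (-r)).cexp)
        refine h2.congr_deriv ?_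
        simp only [id, Nat.add_sub_cancel]
        push_cast
        ring
      exact h1.comp_ofReal
    have hi1 := (integrableOn_pow_mul_cexp n hr).const_mul ((n : ℂ) + 1)
    have hi2 := (integrableOn_pow_mul_cexp (n + 1) hr).const_mul r
    have hlim : Filter.Tendsto (fun x : ℝ => (x : ℂ) ^ (n + 1) * Complex.exp (-r * x))
        Filter.atTop (nhds 0) := by
      rw [tendsto_zero_iff_norm_tendsto_zero]
      have h := tendsto_rpow_mul_exp_neg_mul_atTop_nhds_zero ((n + 1 : ℕ) : ℝ) r.re hr
      refine h.congr' ?_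
      filter_upwards [Filter.eventually_gt_atTop 0] with x hx
      rw [norm_mul, norm_pow, Complex.norm_exp, Complex.norm_real, Real.norm_of_nonneg hx.le,
        Real.rpow_natCast]
      simp
    have h := integral_Ioi_of_hasDerivAt_of_tendsto' hd (hi1.sub hi2) hlim
    rw [integral_sub hi1 hi2, integral_const_mul, integral_const_mul, ih] at h
    have h3 : r * ∫ x in Set.Ioi (0 : ℝ), (x : ℂ) ^ (n + 1) * Complex.exp (-r * x) =
        (n + 1) * (n.factorial / r ^ (n + 1)) := by
      simp only [Complex.ofReal_zero, zero_pow n.succ_ne_zero, zero_mul, sub_zero] at h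
      exact (sub_eq_zero.1 h).symm
    rw [Nat.factorial_succ, eq_div_iff (pow_ne_zero _ hr0), pow_succ r (n + 1), mul_comm (r ^ (n + 1)),
      ← mul_assoc, mul_comm _ r, h3]
    push_cast
    field_simp

lemma charFun_gammaMeasure {v : ℕ} (hv : 1 ≤ v) {b : ℝ} (hb : 0 < b) (t : ℝ) :
    charFun (gammaMeasure v b) t = ((b : ℂ) / (-(t * Complex.I) + b)) ^ v := by
  have hv0 : (0 : ℝ) < v := by exact_mod_cast hv
  have hre : 0 < ((b : ℂ) - t * Complex.I).re := by simpa using hb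
  have hne : (b : ℂ) - t * Complex.I ≠ 0 := fun h => by simp [h] at hre
  have hmeas : Measurable (gammaPDF v b) := (measurable_gammaPDFReal v b).ennreal_ofReal
  rw [charFun_apply_real, gammaMeasure, integral_withDensity_eq_integral_toReal_smul hmeas
    (ae_of_all _ fun x => ENNReal.ofReal_lt_top)]
  have h1 : ∫ x, (gammaPDF v b x).toReal • Complex.exp (t * x * Complex.I) =
      ∫ x in Set.Ioi (0 : ℝ), ((b : ℂ) ^ v / (Real.Gamma v : ℂ)) *
        ((x : ℂ) ^ (v - 1) * Complex.exp (-(b - t * Complex.I) * x)) := by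
    rw [← integral_Ici_eq_integral_Ioi, ← integral_indicator measurableSet_Ici]
    refine integral_congr_ae (ae_of_all _ fun x => ?_)
    simp only [Set.indicator, Set.mem_Ici, gammaPDF]
    rw [ENNReal.toReal_ofReal (gammaPDFReal_nonneg hv0 hb x), gammaPDFReal]
    split_ifs with hx
    · rw [Complex.real_smul, show (v : ℝ) - 1 = (v - 1 : ℕ) by rw [Nat.cast_sub hv, Nat.cast_one],
        Real.rpow_natCast, Real.rpow_natCast]
      push_cast
      rw [mul_assoc, mul_assoc, ← Complex.exp_add]
      ring_nf
    · simp
  rw [h1, integral_const_mul, integral_pow_mul_cexp _ hre, Nat.sub_add_cancel hv]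
  have hG : (Real.Gamma v : ℂ) = (v - 1).factorial := by
    obtain ⟨n, rfl⟩ : ∃ n, v = n + 1 := ⟨v - 1, by omega⟩
    push_cast
    rw [Real.Gamma_nat_eq_factorial]
    simp
  have hf : ((v - 1).factorial : ℂ) ≠ 0 := by exact_mod_cast (v - 1).factorial_ne_zero
  rw [hG, neg_add_eq_sub, div_pow]
  field_simp

/-- Characteristic functions determine finite positive measures. The coefficients are split into
positive and negative parts and the negative ones moved to the side of `ν`, so that genuine measures
are compared. -/
lemma measureReal_eq_add_sum_of_charFun {ι : Type*} (J : Finset ι) {ν ν' : Measure ℝ}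
    [IsFiniteMeasure ν] [IsFiniteMeasure ν'] {ρ : ι → Measure ℝ} (hρ : ∀ j ∈ J, IsFiniteMeasure (ρ j))
    (c : ι → ℝ) (h : ∀ t, charFun ν t = charFun ν' t + ∑ j ∈ J, c j * charFun (ρ j) t)
    (s : Set ℝ) : ν.real s = ν'.real s + ∑ j ∈ J, c j * (ρ j).real s := by
  have key : ∀ a : ι → ℝ≥0, IsFiniteMeasure (∑ j ∈ J, a j • ρ j) := by
    intro a
    refine ⟨?_⟩
    rw [Measure.finsetSum_apply]
    refine ENNReal.sum_lt_top.2 fun j hj => ?_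
    have := hρ j hj
    exact measure_lt_top (a j • ρ j) Set.univ
  have key2 : ∀ (a : ι → ℝ≥0) (t : ℝ), charFun (∑ j ∈ J, a j • ρ j) t =
      ∑ j ∈ J, (a j : ℂ) * charFun (ρ j) t := by
    intro a t
    simp only [charFun_apply_real]
    rw [integral_finsetSum_measure]
    · refine Finset.sum_congr rfl fun j hj => ?_
      rw [integral_smul_nnreal_measure, NNReal.smul_def, Complex.real_smul]
    · intro j hj
      have := hρ j hj
      refine Integrable.of_bound (C := 1) (by fun_prop) (ae_of_all _ fun x => ?_)
      rw [← Complex.ofReal_mul, Complex.norm_exp_ofReal_mul_I]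
  have key3 : ∀ (a : ι → ℝ≥0), (∑ j ∈ J, a j • ρ j).real s = ∑ j ∈ J, (a j : ℝ) * (ρ j).real s := by
    intro a
    rw [measureReal_def, Measure.finsetSum_apply, ENNReal.toReal_sum]
    · exact Finset.sum_congr rfl fun j _ => measureReal_nnreal_smul_apply (a j)
    · intro j hj
      have := hρ j hj
      exact measure_ne_top (a j • ρ j) s
  have := key fun j => (-c j).toNNReal
  have := key fun j => (c j).toNNReal
  have hadd : ∀ (α β : Measure ℝ) [IsFiniteMeasure α] [IsFiniteMeasure β] (t : ℝ),
      charFun (α + β) t = charFun α t + charFun β t := by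
    intro α β _ _ t
    simp only [charFun_apply_real]
    have hi : ∀ (α : Measure ℝ) [IsFiniteMeasure α],
        Integrable (fun x : ℝ => Complex.exp (t * x * Complex.I)) α := fun α _ => by
      refine Integrable.of_bound (C := 1) (by fun_prop) (ae_of_all _ fun x => ?_)
      rw [← Complex.ofReal_mul, Complex.norm_exp_ofReal_mul_I]
    exact integral_add_measure (hi α) (hi β)
  have heq : ν + ∑ j ∈ J, (-c j).toNNReal • ρ j = ν' + ∑ j ∈ J, (c j).toNNReal • ρ j := by
    refine Measure.ext_of_charFun (funext fun t => ?_)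
    rw [hadd, hadd, key2, key2, h, add_assoc, ← Finset.sum_add_distrib]
    congr 1
    refine Finset.sum_congr rfl fun j _ => ?_
    rw [← add_mul]
    congr 1
    have : c j + ((-c j).toNNReal : ℝ) = ((c j).toNNReal : ℝ) := by
      rw [Real.coe_toNNReal', Real.coe_toNNReal']
      rcases le_total 0 (c j) with h | h <;> simp [h]
    exact_mod_cast congrArg (Complex.ofReal) this
  have h3 := congrArg (fun α : Measure ℝ => α.real s) heq
  rw [measureReal_add_apply, measureReal_add_apply, key3, key3] at h3
  have h4 : ∑ j ∈ J, ((c j).toNNReal : ℝ) * (ρ j).real s - ∑ j ∈ J, ((-c j).toNNReal : ℝ) * (ρ j).real s =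
      ∑ j ∈ J, c j * (ρ j).real s := by
    rw [← Finset.sum_sub_distrib]
    refine Finset.sum_congr rfl fun j _ => ?_
    rw [← sub_mul]
    congr 1
    rw [Real.coe_toNNReal', Real.coe_toNNReal']
    rcases le_total 0 (c j) with h | h <;> simp [h]
  linarith

/-! ### The distribution of the signal -/

section Signal

variable {Ω : Type*} [MeasurableSpace Ω] {K M : ℕ} {N : Params K M} {W : Vars Ω K M}
  {μ : Measure Ω} [IsProbabilityMeasure μ]

/-- With `z = -it` and `a = ω_i^η` this is `q + (1 - q) a/(z + a) = q (z + a/q)/(z + a)`, the origin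
of the multiset `OmHat`. -/
lemma IsModel.charFun_link (hW : IsModel N W μ) (t : ℝ) (i : Fin K) :
    ∫ ω, (if W.on i ω then Complex.exp (t * (N.nd i ^ (-N.η) * W.H i ω : ℝ) * Complex.I) else 1) ∂μ =
      N.q i * ((-(t * Complex.I) + (N.nd i ^ N.η / N.q i : ℝ)) /
        (-(t * Complex.I) + (N.nd i ^ N.η : ℝ))) := by
  have hpos := N.nd_pos i
  set a : ℝ := N.nd i ^ N.η with ha
  have hapos : 0 < a := Real.rpow_pos_of_pos hpos _
  have hr : N.nd i ^ (-N.η) = a⁻¹ := Real.rpow_neg hpos.le _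
  have hq := N.q_pos i
  have hi : IndepFun (W.on i) (W.H i) μ :=
    hW.indepFun (S := {Source.on i}) (T := {Source.H i}) (by simp) (W.measurable_on rfl)
      (W.measurable_H rfl)
  rw [integral_gate (hW.meas_on i) (hW.meas_H i) hi (hW.prob_on i)
    (f := fun h => Complex.exp (t * (N.nd i ^ (-N.η) * h : ℝ) * Complex.I)) (by fun_prop)]
  · have hchar : ∫ ω, Complex.exp (t * (N.nd i ^ (-N.η) * W.H i ω : ℝ) * Complex.I) ∂μ =
        charFun (gammaMeasure (1 : ℕ) 1) (t * a⁻¹) := by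
      have hlaw := (hW.law_H i).map_eq
      rw [expMeasure] at hlaw
      rw [Nat.cast_one, ← hlaw, charFun_apply_real, integral_map (hW.meas_H i).aemeasurable (by fun_prop), hr]
      refine integral_congr_ae (ae_of_all _ fun ω => ?_)
      simp only
      push_cast
      ring_nf
    rw [hchar, charFun_gammaMeasure le_rfl one_pos]
    have hne : -((t : ℂ) * Complex.I) + (a : ℝ) ≠ 0 := by
      intro h
      have := congrArg Complex.re h
      simp at this
      exact hapos.ne' this
    have ha' : (a : ℂ) ≠ 0 := by exact_mod_cast hapos.ne'
    have hq' : (N.q i : ℂ) ≠ 0 := by exact_mod_cast hq.ne'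
    have hne2 : -(((t * a⁻¹ : ℝ) : ℂ) * Complex.I) + (1 : ℝ) ≠ 0 := by
      intro h
      have := congrArg Complex.re h
      simp at this
    have hden : -(((t * a⁻¹ : ℝ) : ℂ) * Complex.I) + (1 : ℝ) = (-((t : ℂ) * Complex.I) + (a : ℝ)) / a := by
      push_cast
      field_simp
    rw [hden, pow_one]
    push_cast
    field_simp
    ring
  · refine Integrable.of_bound (C := 1) ?_ (ae_of_all _ fun ω => ?_)
    · have := hW.meas_H i
      exact (Measurable.aestronglyMeasurable (by fun_prop))
    · rw [← Complex.ofReal_mul, Complex.norm_exp_ofReal_mul_I]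

lemma IsModel.integral_prod_link (hW : IsModel N W μ) (t : ℝ) (s : Finset (Fin K)) :
    ∫ ω, ∏ i ∈ s, (if W.on i ω then Complex.exp (t * (N.nd i ^ (-N.η) * W.H i ω : ℝ) * Complex.I)
        else 1) ∂μ =
      ∏ i ∈ s, ∫ ω, (if W.on i ω then
        Complex.exp (t * (N.nd i ^ (-N.η) * W.H i ω : ℝ) * Complex.I) else 1) ∂μ := by
  induction s using Finset.induction_on with
  | empty => simp
  | insert i s hi ih =>
    simp only [Finset.prod_insert hi]
    rw [← ih]
    have hmf : ∀ j, Measurable fun h : ℝ =>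
        Complex.exp (t * (N.nd j ^ (-N.η) * h : ℝ) * Complex.I) := fun j => by fun_prop
    have hS : Measurable[W.alg {Source.on i, Source.H i}] fun ω => if W.on i ω then
        Complex.exp (t * (N.nd i ^ (-N.η) * W.H i ω : ℝ) * Complex.I) else 1 :=
      W.measurable_ite_on (by simp) (by simp) (hmf i) 1
    have hT : Measurable[W.alg {x | ∃ j ∈ s, x = Source.on j ∨ x = Source.H j}] fun ω =>
        ∏ j ∈ s, (if W.on j ω then Complex.exp (t * (N.nd j ^ (-N.η) * W.H j ω : ℝ) * Complex.I)
          else 1) :=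
      Finset.measurable_fun_prod _ fun j hj =>
        W.measurable_ite_on (Set.mem_ofPred.2 ⟨j, hj, Or.inl rfl⟩)
          (Set.mem_ofPred.2 ⟨j, hj, Or.inr rfl⟩) (hmf j) 1
    have hd : Disjoint ({Source.on i, Source.H i} : Set (Source K M))
        {x | ∃ j ∈ s, x = Source.on j ∨ x = Source.H j} := by
      rw [Set.disjoint_left]
      rintro x (rfl | rfl) ⟨j, hj, h | h⟩ <;> cases h <;> exact hi hj
    exact (hW.indepFun hd hS hT).integral_fun_mul_eq_mul_integral
      (hS.mono (hW.alg_le _) le_rfl).aestronglyMeasurable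
      (hT.mono (hW.alg_le _) le_rfl).aestronglyMeasurable

lemma Params.G_pos (N : Params K M) : 0 < N.G := Finset.prod_pos fun i _ => N.q_pos i

/-- The tail of a sum of Bernoulli-gated exponentials is a signed mixture of Gamma tails. -/
theorem IsModel.ccdf_normSignal (hW : IsModel N W μ) {x : ℝ} (hx : 0 ≤ x) :
    μ.real {ω | x < N.normSignal W ω} =
      N.G * ∑ δ ∈ N.deltas, ∑ v ∈ Finset.Icc 1 (N.mult δ), N.coeff δ v * gammaQ v (δ ^ N.η * x) := by
  have hm := hW.measurable_normSignal
  have : IsProbabilityMeasure (μ.map (N.normSignal W)) := Measure.isProbabilityMeasure_map hm.aemeasurable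
  -- The constant `1` of the partial fraction expansion, times `G`, is the transform of an atom at
  -- `0`: the event that every transmitter is silent.
  have hchar : ∀ t, charFun (μ.map (N.normSignal W)) t =
      charFun (N.G.toNNReal • Measure.dirac (0 : ℝ)) t +
        ∑ j ∈ N.deltas.sigma fun δ => Finset.Icc 1 (N.mult δ),
          (N.G * N.coeff j.1 j.2 : ℝ) * charFun (gammaMeasure j.2 (j.1 ^ N.η)) t := by
    intro t
    have h1 : charFun (μ.map (N.normSignal W)) t = ∫ ω, ∏ i, (if W.on i ω then
        Complex.exp (t * (N.nd i ^ (-N.η) * W.H i ω : ℝ) * Complex.I) else 1) ∂μ := by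
      rw [charFun_apply_real, integral_map hm.aemeasurable (by fun_prop)]
      refine integral_congr_ae (ae_of_all _ fun ω => ?_)
      simp only [Params.normSignal]
      rw [Complex.ofReal_sum, Finset.mul_sum, Finset.sum_mul, Complex.exp_sum]
      refine Finset.prod_congr rfl fun i _ => ?_
      split_ifs <;> simp
    have hz : ∀ i, -((t : ℂ) * Complex.I) + (N.nd i ^ N.η : ℝ) ≠ 0 := by
      intro i h
      have := congrArg Complex.re h
      simp at this
      exact (Real.rpow_pos_of_pos (N.nd_pos i) N.η).ne' this
    rw [h1, hW.integral_prod_link, Finset.prod_congr rfl fun i _ => hW.charFun_link t i,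
      Finset.prod_mul_distrib, N.prod_div_prod_eq hz, mul_add, mul_one, ← Complex.ofReal_prod,
      Finset.sum_sigma', Finset.mul_sum]
    congr 1
    · rw [charFun_apply_real, integral_smul_nnreal_measure]
      simp only [NNReal.smul_def, Real.coe_toNNReal _ N.G_pos.le]
      simp [Params.G]
    · refine Finset.sum_congr rfl fun j hj => ?_
      rw [Finset.mem_sigma, Finset.mem_Icc] at hj
      rw [charFun_gammaMeasure hj.2.1 (Real.rpow_pos_of_pos (N.pos_of_mem_deltas hj.1) _)]
      simp only [Params.G]
      push_cast
      ring
  have h := measureReal_eq_add_sum_of_charFun _ (fun j hj => by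
    rw [Finset.mem_sigma, Finset.mem_Icc] at hj
    have := isProbabilityMeasure_gammaMeasure (a := j.2) (r := j.1 ^ N.η)
      (by exact_mod_cast hj.2.1) (Real.rpow_pos_of_pos (N.pos_of_mem_deltas hj.1) _)
    infer_instance) _ hchar (Set.Ioi x)
  rw [map_measureReal_apply hm measurableSet_Ioi] at h
  have h0 : (N.G.toNNReal • Measure.dirac (0 : ℝ)).real (Set.Ioi x) = 0 := by
    rw [measureReal_nnreal_smul_apply, measureReal_def, Measure.dirac_apply' _ measurableSet_Ioi]
    simp [hx]
  rw [h0, zero_add] at h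
  have hset : {ω | x < N.normSignal W ω} = N.normSignal W ⁻¹' Set.Ioi x := rfl
  rw [hset, h, Finset.mul_sum, Finset.sum_sigma]
  refine Finset.sum_congr rfl fun δ hδ => ?_
  rw [Finset.mul_sum]
  refine Finset.sum_congr rfl fun v hv => ?_
  rw [Finset.mem_Icc] at hv
  rw [gammaMeasure_real_Ioi (by exact_mod_cast hv.1)
    (Real.rpow_pos_of_pos (N.pos_of_mem_deltas hδ) _) hx, mul_assoc]

end Signal

/-! ### The exponential `e^(-y)` on `[0, ∞]` -/

/-- `y ↦ e^(-y)` on `[0, ∞]`, with `e^(-∞) = 0`. -/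
noncomputable def expNeg (y : ℝ≥0∞) : ℝ≥0∞ := EReal.exp (-(y : EReal))

@[simp] lemma expNeg_zero : expNeg 0 = 1 := by simp [expNeg]

@[simp] lemma expNeg_top : expNeg ∞ = 0 := by simp [expNeg]

lemma expNeg_add (x y : ℝ≥0∞) : expNeg (x + y) = expNeg x * expNeg y := by
  rw [expNeg, EReal.coe_ennreal_add, EReal.neg_add (Or.inl (EReal.coe_ennreal_ne_bot x))
    (Or.inr (EReal.coe_ennreal_ne_bot y)), sub_eq_add_neg, EReal.exp_add, expNeg, expNeg]

lemma continuous_expNeg : Continuous expNeg :=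
  ENNReal.continuous_exp.comp (continuous_neg.comp continuous_coe_ennreal_ereal)

lemma measurable_expNeg : Measurable expNeg := continuous_expNeg.measurable

lemma expNeg_le_one (x : ℝ≥0∞) : expNeg x ≤ 1 := by
  simp [expNeg, EReal.coe_ennreal_nonneg]

lemma expNeg_anti : Antitone expNeg := fun _ _ h =>
  EReal.exp_monotone (EReal.neg_le_neg_iff.2 (EReal.coe_ennreal_le_coe_ennreal_iff.2 h))

lemma expNeg_ne_top (x : ℝ≥0∞) : expNeg x ≠ ∞ := ((expNeg_le_one x).trans_lt ENNReal.one_lt_top).ne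

lemma expNeg_ofReal {x : ℝ} (hx : 0 ≤ x) :
    expNeg (ENNReal.ofReal x) = ENNReal.ofReal (Real.exp (-x)) := by
  rw [expNeg, EReal.coe_ennreal_ofReal, max_eq_left hx, ← EReal.coe_neg, EReal.exp_coe]

lemma expNeg_eq_ofReal {x : ℝ≥0∞} (hx : x ≠ ∞) :
    expNeg x = ENNReal.ofReal (Real.exp (-x.toReal)) := by
  rw [← expNeg_ofReal ENNReal.toReal_nonneg, ENNReal.ofReal_toReal hx]

lemma expNeg_sum {ι : Type*} (s : Finset ι) (f : ι → ℝ≥0∞) :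
    expNeg (∑ i ∈ s, f i) = ∏ i ∈ s, expNeg (f i) := by
  classical
  induction s using Finset.induction_on with
  | empty => simp
  | insert i s hi ih => rw [Finset.sum_insert hi, Finset.prod_insert hi, expNeg_add, ih]

lemma expNeg_mul_natCast (c : ℝ≥0∞) (n : ℕ) : expNeg (c * n) = expNeg c ^ n := by
  have h := expNeg_sum (Finset.range n) fun _ => c
  simpa [mul_comm] using h

/-! ### The Laplace functional of a Poisson process -/

/-- The generating function of the Poisson law at `e^(-c)`. The value `c = ∞` is included and gives
the probability of the count `0`. -/
lemma lintegral_expNeg_poissonMeasure (r : ℝ≥0) (c : ℝ≥0∞) :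
    ∫⁻ n : ℕ, expNeg (c * n) ∂(poissonMeasure r) = expNeg (r * (1 - expNeg c)) := by
  have hx0 : (0 : ℝ) ≤ (expNeg c).toReal := ENNReal.toReal_nonneg
  have hx1 : (expNeg c).toReal ≤ 1 := by
    simpa using ENNReal.toReal_mono ENNReal.one_ne_top (expNeg_le_one c)
  have hx : expNeg c = ENNReal.ofReal (expNeg c).toReal :=
    (ENNReal.ofReal_toReal (expNeg_ne_top c)).symm
  set x := (expNeg c).toReal
  have hterm : ∀ n : ℕ, ENNReal.ofReal (Real.exp (-r) * r ^ n / n.factorial) * expNeg (c * n) =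
      ENNReal.ofReal (Real.exp (-r) * ((r * x) ^ n / n.factorial)) := by
    intro n
    rw [expNeg_mul_natCast, hx, ← ENNReal.ofReal_pow hx0, ← ENNReal.ofReal_mul (by positivity)]
    congr 1
    rw [mul_pow]
    ring
  have hsum : HasSum (fun n : ℕ => Real.exp (-r) * ((r * x) ^ n / n.factorial))
      (Real.exp (-r) * Real.exp (r * x)) := by
    rw [Real.exp_eq_exp_ℝ]
    exact (NormedSpace.expSeries_div_hasSum_exp (r * x : ℝ)).mul_left _
  rw [poissonMeasure, lintegral_sum_measure]
  simp only [lintegral_smul_measure, lintegral_dirac, smul_eq_mul, hterm]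
  rw [← ENNReal.ofReal_tsum_of_nonneg (fun n => by positivity) hsum.summable, hsum.tsum_eq, hx,
    ← ENNReal.ofReal_one, ← ENNReal.ofReal_sub _ hx0, ← ENNReal.ofReal_coe_nnreal,
    ← ENNReal.ofReal_mul r.coe_nonneg, expNeg_ofReal (mul_nonneg r.coe_nonneg (by linarith)),
    ← Real.exp_add]
  congr 2
  ring

lemma lintegral_points {Ω : Type*} (X : ℕ → Ω → Plane) {f : Plane → ℝ≥0∞} (hf : Measurable f) (ω : Ω) :
    ∫⁻ x, f x ∂(Measure.sum fun i => Measure.dirac (X i ω)) = ∑' i, f (X i ω) := by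
  rw [lintegral_sum_measure]
  simp only [lintegral_dirac' _ hf]

section Laplace

variable {Ω : Type*} [MeasurableSpace Ω] {X : ℕ → Ω → Plane} {Λ : Measure Plane} {μ : Measure Ω}

lemma IsPoissonProcess.lintegral_expNeg_count (hX : IsPoissonProcess X Λ μ) {B : Set Plane}
    (hB : MeasurableSet B) (hfin : Λ B < ∞) (c : ℝ≥0∞) :
    ∫⁻ ω, expNeg (c * count X B ω) ∂μ = expNeg (Λ B * (1 - expNeg c)) := by
  have hm : Measurable fun y : ℝ≥0∞ => expNeg (c * y) := measurable_expNeg.comp (by fun_prop)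
  rw [(hX.poisson B hB hfin).lintegral_comp hm.aemeasurable, lintegral_map hm .of_discrete,
    lintegral_expNeg_poissonMeasure, ENNReal.coe_toNNReal hfin.ne]

lemma IsPoissonProcess.measurable_tsum (hX : IsPoissonProcess X Λ μ) {f : Plane → ℝ≥0∞}
    (hf : Measurable f) : Measurable fun ω => ∑' i, f (X i ω) :=
  Measurable.tsum fun i => hf.comp (hX.measurable i)

lemma IsPoissonProcess.measurable_count (hX : IsPoissonProcess X Λ μ) {B : Set Plane}
    (hB : MeasurableSet B) : Measurable (count X B) := by
  have h : count X B = fun ω => ∑' i, B.indicator (fun _ => (1 : ℝ≥0∞)) (X i ω) := by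
    ext ω
    rw [count, Measure.sum_apply _ hB]
    simp only [Measure.dirac_apply' _ hB]
    rfl
  rw [h]
  exact hX.measurable_tsum (measurable_const.indicator hB)

/-- The level sets are disjoint, so the point counts on them are independent Poisson variables and
the expectation factors. The value `0` is left out: it contributes nothing, and its level set may
have infinite intensity. -/
lemma IsPoissonProcess.laplace_simpleFunc (hX : IsPoissonProcess X Λ μ) (f : SimpleFunc Plane ℝ≥0∞)
    (hfin : ∀ c, c ≠ 0 → Λ (f ⁻¹' {c}) < ∞) :
    ∫⁻ ω, expNeg (∑' i, f (X i ω)) ∂μ = expNeg (∫⁻ x, (1 - expNeg (f x)) ∂Λ) := by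
  classical
  set R := f.range.filter (· ≠ 0) with hR
  have hLHS : ∀ ω, ∑' i, f (X i ω) = ∑ c ∈ R, c * count X (f ⁻¹' {c}) ω := by
    intro ω
    rw [← lintegral_points X f.measurable, SimpleFunc.lintegral_eq_lintegral, SimpleFunc.lintegral, hR,
      Finset.sum_filter_of_ne]
    · rfl
    · rintro c - h rfl
      simp at h
  have hRHS : ∫⁻ x, (1 - expNeg (f x)) ∂Λ = ∑ c ∈ R, Λ (f ⁻¹' {c}) * (1 - expNeg c) := by
    have h := SimpleFunc.map_lintegral (fun y => 1 - expNeg y) f (μ := Λ)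
    rw [← SimpleFunc.lintegral_eq_lintegral] at h
    rw [hR, Finset.sum_filter_of_ne]
    · simp only [mul_comm (Λ _)]
      exact h
    · rintro c - h rfl
      simp at h
  let e : Fin R.card ≃ R := R.equivFin.symm
  have hindep := hX.indep R.card (fun j => f ⁻¹' {(e j : ℝ≥0∞)})
    (fun j => f.measurableSet_fiber _) (fun i j hij => by
      refine Disjoint.preimage _ (Set.disjoint_singleton.2 fun h => hij ?_)
      exact e.injective (Subtype.ext h))
  have hindep' : iIndepFun (fun j ω => expNeg ((e j : ℝ≥0∞) * count X (f ⁻¹' {(e j : ℝ≥0∞)}) ω)) μ :=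
    hindep.comp (fun j y => expNeg ((e j : ℝ≥0∞) * y)) fun j => measurable_expNeg.comp (by fun_prop)
  have hprod : ∀ g : ℝ≥0∞ → ℝ≥0∞, ∏ c ∈ R, g c = ∏ j, g (e j) := by
    intro g
    rw [← Finset.prod_coe_sort, ← e.prod_comp]
  simp_rw [hLHS, hRHS, expNeg_sum, hprod]
  rw [lintegral_prod_eq_prod_lintegral_of_indepFun _ _ hindep'
    fun j => measurable_expNeg.comp ((hX.measurable_count (f.measurableSet_fiber _)).const_mul _)]
  refine Finset.prod_congr rfl fun j _ => ?_
  exact hX.lintegral_expNeg_count (f.measurableSet_fiber _)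
    (hfin _ (Finset.mem_filter.1 (e j).2).2) _

/-- The Laplace functional of a Poisson process. -/
theorem IsPoissonProcess.laplace [IsProbabilityMeasure μ] [SigmaFinite Λ]
    (hX : IsPoissonProcess X Λ μ) {f : Plane → ℝ≥0∞} (hf : Measurable f) :
    ∫⁻ ω, expNeg (∑' i, f (X i ω)) ∂μ = expNeg (∫⁻ x, (1 - expNeg (f x)) ∂Λ) := by
  -- Restriction to the spanning sets gives the nonzero level sets finite intensity and keeps the
  -- approximation increasing to `f`.
  let g : ℕ → SimpleFunc Plane ℝ≥0∞ := fun n =>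
    (SimpleFunc.eapprox f n).restrict (spanningSets Λ n)
  have hg : ∀ n x, g n x = (spanningSets Λ n).indicator (SimpleFunc.eapprox f n) x := fun n x =>
    SimpleFunc.restrict_apply _ (measurableSet_spanningSets Λ n) x
  have hmono : ∀ x, Monotone fun n => g n x := by
    intro x i j hij
    simp only [hg]
    by_cases hx : x ∈ spanningSets Λ i
    · rw [Set.indicator_of_mem hx, Set.indicator_of_mem (monotone_spanningSets Λ hij hx)]
      exact SimpleFunc.monotone_eapprox f hij x
    · rw [Set.indicator_of_notMem hx]
      exact zero_le
  have htend : ∀ x, Filter.Tendsto (fun n => g n x) Filter.atTop (nhds (f x)) := by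
    intro x
    have h := tendsto_atTop_iSup (fun i j hij => SimpleFunc.monotone_eapprox f hij x :
      Monotone fun n => SimpleFunc.eapprox f n x)
    rw [SimpleFunc.iSup_eapprox_apply hf] at h
    refine h.congr' ?_
    filter_upwards [Filter.eventually_ge_atTop (spanningSetsIndex Λ x)] with n hn
    rw [hg, Set.indicator_of_mem (mem_spanningSets_of_index_le Λ x hn)]
  have hfin : ∀ n c, c ≠ 0 → Λ (g n ⁻¹' {c}) < ∞ := by
    intro n c hc
    refine (measure_mono fun x hx => ?_).trans_lt (measure_spanningSets_lt_top Λ n)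
    by_contra hx'
    rw [Set.mem_preimage, hg, Set.indicator_of_notMem hx'] at hx
    exact hc hx.symm
  have hL : Filter.Tendsto (fun n => ∫⁻ ω, expNeg (∑' i, g n (X i ω)) ∂μ) Filter.atTop
      (nhds (∫⁻ ω, expNeg (∑' i, f (X i ω)) ∂μ)) := by
    refine tendsto_lintegral_of_dominated_convergence (fun _ => 1)
      (fun n => measurable_expNeg.comp (hX.measurable_tsum (g n).measurable))
      (fun n => ae_of_all _ fun ω => expNeg_le_one _) (by simp) (ae_of_all _ fun ω => ?_)
    refine (continuous_expNeg.tendsto _).comp ?_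
    simp only [← lintegral_points X hf, ← lintegral_points X (g _).measurable]
    exact lintegral_tendsto_of_tendsto_of_monotone (fun n => (g n).measurable.aemeasurable)
      (ae_of_all _ hmono) (ae_of_all _ htend)
  have hR : Filter.Tendsto (fun n => expNeg (∫⁻ x, (1 - expNeg (g n x)) ∂Λ)) Filter.atTop
      (nhds (expNeg (∫⁻ x, (1 - expNeg (f x)) ∂Λ))) := by
    refine (continuous_expNeg.tendsto _).comp ?_
    refine lintegral_tendsto_of_tendsto_of_monotone
      (fun n => (measurable_const.sub (measurable_expNeg.comp (g n).measurable)).aemeasurable)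
      (ae_of_all _ fun x i j hij => tsub_le_tsub_left (expNeg_anti (hmono x hij)) 1)
      (ae_of_all _ fun x => ?_)
    exact ENNReal.Tendsto.sub tendsto_const_nhds ((continuous_expNeg.tendsto _).comp (htend x))
      (Or.inl ENNReal.one_ne_top)
  refine tendsto_nhds_unique hL (hR.congr fun n => ?_)
  exact (hX.laplace_simpleFunc (g n) (hfin n)).symm

end Laplace

/-! ### Radial integrals in the plane -/

/-- Polar coordinates: the punctured plane is the unit circle, of mass twice the area of the unit
disc, times the half-line with measure `r dr`. -/
lemma lintegral_plane_norm {f : ℝ → ℝ≥0∞} (hf : Measurable f) :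
    ∫⁻ x : Plane, f ‖x‖ =
      ENNReal.ofReal (2 * Real.pi) * ∫⁻ r in Set.Ioi (0 : ℝ), ENNReal.ofReal r * f r := by
  have hdim : Module.finrank ℝ Plane = 2 := by simp [Plane]
  have hsphere : (volume : Measure Plane).toSphere Set.univ = ENNReal.ofReal (2 * Real.pi) := by
    rw [Measure.toSphere_apply_univ, hdim, EuclideanSpace.volume_ball_fin_two,
      ENNReal.ofReal_mul zero_le_two]
    simp
  calc ∫⁻ x : Plane, f ‖x‖ = ∫⁻ x : ({(0)}ᶜ : Set Plane), f ‖x.1‖ ∂(volume.comap Subtype.val) := by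
        rw [lintegral_subtype_comap (measurableSet_singleton _).compl fun x : Plane => f ‖x‖,
          restrict_compl_singleton]
    _ = ∫⁻ x, f x.2 ∂(volume : Measure Plane).toSphere.prod
          (Measure.volumeIoiPow (Module.finrank ℝ Plane - 1)) := by
        have hm : Measurable fun x : Metric.sphere (0 : Plane) 1 × Set.Ioi (0 : ℝ) => f x.2 :=
          hf.comp (measurable_subtype_coe.comp measurable_snd)
        rw [← (volume : Measure Plane).measurePreserving_homeomorphUnitSphereProd.lintegral_comp hm]
        simp
    _ = (volume : Measure Plane).toSphere Set.univ *
          ∫⁻ x : Set.Ioi (0 : ℝ), f x ∂(Measure.volumeIoiPow (Module.finrank ℝ Plane - 1)) := by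
        have hm : Measurable fun x : Metric.sphere (0 : Plane) 1 × Set.Ioi (0 : ℝ) => f x.2 :=
          hf.comp (measurable_subtype_coe.comp measurable_snd)
        rw [lintegral_prod _ hm.aemeasurable]
        simp only [lintegral_const]
        rw [mul_comm]
    _ = _ := by
        have hm : Measurable fun x : Set.Ioi (0 : ℝ) => f x := hf.comp measurable_subtype_coe
        rw [hsphere, hdim, Measure.volumeIoiPow,
          lintegral_withDensity_eq_lintegral_mul _ (by fun_prop) hm]
        congr 1
        have h := lintegral_subtype_comap (μ := volume) measurableSet_Ioi
          (s := Set.Ioi (0 : ℝ)) fun r : ℝ => ENNReal.ofReal r * f r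
        rw [← h]
        simp

/-- `a r^(-η) / (1 + a r^(-η))` -/
noncomputable def shot (η a r : ℝ) : ℝ := a * r ^ (-η) / (1 + a * r ^ (-η))

lemma measurable_shot (η a : ℝ) : Measurable (shot η a) := by
  unfold shot
  fun_prop

lemma shot_nonneg {η a r : ℝ} (ha : 0 ≤ a) (hr : 0 ≤ r) : 0 ≤ shot η a r := by
  unfold shot
  positivity

lemma shot_zero (η r : ℝ) : shot η 0 r = 0 := by simp [shot]

lemma lintegral_exp_neg_mul {c : ℝ} (hc : 0 < c) :
    ∫⁻ t in Set.Ioi (0 : ℝ), ENNReal.ofReal (Real.exp (-c * t)) = ENNReal.ofReal (1 / c) := by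
  have hi := integrableOn_exp_mul_Ioi (a := -c) (by linarith) 0
  rw [← ofReal_integral_eq_lintegral_ofReal hi (ae_of_all _ fun t => (Real.exp_pos _).le),
    integral_exp_mul_Ioi (by linarith) 0]
  simp [one_div]

lemma lintegral_rpow_mul_exp_neg_mul_rpow {p q b : ℝ} (hp : 0 < p) (hq : -1 < q) (hb : 0 < b) :
    ∫⁻ x in Set.Ioi (0 : ℝ), ENNReal.ofReal (x ^ q * Real.exp (-b * x ^ p)) =
      ENNReal.ofReal (b ^ (-(q + 1) / p) * (1 / p) * Real.Gamma ((q + 1) / p)) := by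
  rw [← integral_rpow_mul_exp_neg_mul_rpow hp hq hb, ofReal_integral_eq_lintegral_ofReal
    (integrableOn_rpow_mul_exp_neg_mul_rpow hq hp hb)]
  filter_upwards [ae_restrict_mem measurableSet_Ioi] with x hx
  have : (0 : ℝ) < x := hx
  simp only [Pi.zero_apply]
  positivity

/-- For `r > 0` the shot is `1/(1 + r^η/a) = ∫ e^(-(1 + r^η/a) t) dt`. After exchanging the
integrals by Tonelli, each one is a Gamma integral; the one in `t` converges at `0` because `2/η <
1`. -/
lemma lintegral_shot_Ioi {η a : ℝ} (hη : 2 < η) (ha : 0 < a) :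
    ∫⁻ r in Set.Ioi (0 : ℝ), ENNReal.ofReal r * ENNReal.ofReal (shot η a r) =
      ENNReal.ofReal (1 / 2 * a ^ (2 / η) * Real.Gamma (1 + 2 / η) * Real.Gamma (1 - 2 / η)) := by
  have hη0 : 0 < η := by linarith
  have h2η : 2 / η < 1 := by rw [div_lt_one hη0]; exact hη
  have h1 : ∀ r ∈ Set.Ioi (0 : ℝ), ENNReal.ofReal r * ENNReal.ofReal (shot η a r) =
      ∫⁻ t in Set.Ioi (0 : ℝ), ENNReal.ofReal (r * Real.exp (-(1 + r ^ η / a) * t)) := by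
    intro r hr
    have hr : 0 < r := hr
    have hp : 0 < r ^ η := Real.rpow_pos_of_pos hr _
    simp only [ENNReal.ofReal_mul hr.le]
    rw [lintegral_const_mul _ (by fun_prop), lintegral_exp_neg_mul (by positivity), shot,
      Real.rpow_neg hr.le]
    congr 2
    field_simp
    ring
  have h2 : ∀ t ∈ Set.Ioi (0 : ℝ),
      ∫⁻ r in Set.Ioi (0 : ℝ), ENNReal.ofReal (r * Real.exp (-(1 + r ^ η / a) * t)) =
        ENNReal.ofReal (a ^ (2 / η) * (1 / η) * Real.Gamma (2 / η)) *
          ENNReal.ofReal (t ^ (-(2 / η)) * Real.exp (-1 * t ^ (1 : ℝ))) := by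
    intro t ht
    have ht : 0 < t := ht
    have h3 : ∀ r : ℝ, ENNReal.ofReal (r * Real.exp (-(1 + r ^ η / a) * t)) =
        ENNReal.ofReal (Real.exp (-t)) * ENNReal.ofReal (r ^ (1 : ℝ) * Real.exp (-(t / a) * r ^ η)) := by
      intro r
      rw [← ENNReal.ofReal_mul (Real.exp_pos _).le, Real.rpow_one, mul_left_comm, ← Real.exp_add]
      congr 3
      ring
    simp_rw [h3]
    rw [lintegral_const_mul _ (by fun_prop),
      lintegral_rpow_mul_exp_neg_mul_rpow hη0 (by norm_num) (by positivity),
      ← ENNReal.ofReal_mul (Real.exp_pos _).le, ← ENNReal.ofReal_mul (by positivity)]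
    congr 1
    have h4 : -((1 : ℝ) + 1) / η = -(2 / η) := by ring
    have h5 : ((1 : ℝ) + 1) / η = 2 / η := by ring
    rw [h4, h5, Real.div_rpow ht.le ha.le, Real.rpow_neg ha.le, Real.rpow_one, neg_one_mul]
    field_simp
  rw [setLIntegral_congr_fun measurableSet_Ioi h1, lintegral_lintegral_swap
    (Measurable.aemeasurable (by fun_prop)), setLIntegral_congr_fun measurableSet_Ioi h2,
    lintegral_const_mul _ (by fun_prop),
    lintegral_rpow_mul_exp_neg_mul_rpow one_pos (by linarith) one_pos,
    ← ENNReal.ofReal_mul (by positivity)]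
  congr 1
  have h6 : (-(2 / η) + 1) / 1 = 1 - 2 / η := by ring
  rw [h6, Real.one_rpow, add_comm 1 (2 / η), Real.Gamma_add_one (by positivity)]
  field_simp

lemma lintegral_shot_plane {η a : ℝ} (hη : 2 < η) (ha : 0 ≤ a) :
    ∫⁻ x : Plane, ENNReal.ofReal (shot η a ‖x‖) =
      ENNReal.ofReal (Real.pi * a ^ (2 / η) * Real.Gamma (1 + 2 / η) * Real.Gamma (1 - 2 / η)) := by
  have hη0 : 0 < η := by linarith
  rcases ha.eq_or_lt with rfl | ha
  · simp [shot_zero, Real.zero_rpow (show 2 / η ≠ 0 by positivity)]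
  · rw [lintegral_plane_norm (f := fun r => ENNReal.ofReal (shot η a r))
      (measurable_shot η a).ennreal_ofReal, lintegral_shot_Ioi hη ha,
      ← ENNReal.ofReal_mul (by positivity)]
    congr 1
    ring

/-! ### The integral outside a disc -/

/-- Here `c - b = 1`, so the factor `(1 - y)^(c-b-1)` disappears from Euler's integral and the Gamma
quotient collapses to `1 - 2/η`. -/
lemma calF_eq {η : ℝ} (hη : 2 < η) (t : ℝ) :
    calF t η = 2 * t / η * ∫ y in (0 : ℝ)..1, y ^ (-(2 / η)) * (1 + t * y)⁻¹ := by
  have hη0 : 0 < η := by linarith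
  have hb : 0 < 1 - 2 / η := by
    rw [sub_pos, div_lt_one hη0]
    exact hη
  have h1 : 2 - 2 / η = (1 - 2 / η) + 1 := by ring
  have h2 : (1 - 2 / η + 1) - (1 - 2 / η) = 1 := by ring
  have h3 : 1 - 2 / η - 1 = -(2 / η) := by ring
  rw [calF, gauss2F1, h1, h2, Real.Gamma_add_one hb.ne', h3]
  simp only [sub_self, Real.rpow_zero, mul_one, neg_mul, sub_neg_eq_add, Real.rpow_neg_one,
    Real.Gamma_one]
  have := (Real.Gamma_pos_of_pos hb).ne'
  have h4 : η - 2 ≠ 0 := by linarith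
  rw [← mul_assoc]
  have h5 : 1 - 2 / η = (η - 2) / η := by field_simp
  congr 1
  rw [h5] at this ⊢
  field_simp

lemma image_rpow_Ioo {η D : ℝ} (hη : 0 < η) (hD : 0 < D) :
    (fun y : ℝ => D * y ^ (-(1 / η))) '' Set.Ioo 0 1 = Set.Ioi D := by
  ext r
  simp only [Set.mem_image, Set.mem_Ioo, Set.mem_Ioi]
  constructor
  · rintro ⟨y, ⟨hy0, hy1⟩, rfl⟩
    have := Real.one_lt_rpow_of_pos_of_lt_one_of_neg hy0 hy1 (show -(1 / η) < 0 by simp [hη])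
    nlinarith
  · intro hr
    have hr0 : 0 < r := hD.trans hr
    have hrD : 1 < r / D := (one_lt_div hD).2 hr
    refine ⟨(r / D) ^ (-η), ⟨by positivity, Real.rpow_lt_one_of_one_lt_of_neg hrD (by linarith)⟩, ?_⟩
    rw [← Real.rpow_mul (by positivity)]
    have : -η * -(1 / η) = 1 := by field_simp
    rw [this, Real.rpow_one]
    field_simp

/-- The substitution `r = D y^(-1/η)`, that is `y = (D/r)^η`, maps `(0, 1)` onto `(D, ∞)` and turns
the shot into `t y/(1 + t y)` with `t = a D^(-η)`, which leads to Euler's integral. -/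
lemma lintegral_shot_Ioi_outer {η a D : ℝ} (hη : 2 < η) (ha : 0 ≤ a) (hD : 0 < D) :
    ∫⁻ r in Set.Ioi D, ENNReal.ofReal r * ENNReal.ofReal (shot η a r) =
      ENNReal.ofReal (1 / 2 * D ^ 2 * calF (a * D ^ (-η)) η) := by
  have hη0 : 0 < η := by linarith
  have h2η : 2 / η < 1 := by rw [div_lt_one hη0]; exact hη
  set t := a * D ^ (-η) with ht
  have ht0 : 0 ≤ t := by positivity
  have hder : ∀ y ∈ Set.Ioo (0 : ℝ) 1, HasDerivWithinAt (fun y : ℝ => D * y ^ (-(1 / η)))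
      (D * (-(1 / η) * y ^ (-(1 / η) - 1))) (Set.Ioo 0 1) y := fun y hy =>
    ((Real.hasDerivAt_rpow_const (Or.inl hy.1.ne')).const_mul D).hasDerivWithinAt
  have hinj : Set.InjOn (fun y : ℝ => D * y ^ (-(1 / η))) (Set.Ioo 0 1) := by
    intro x hx y hy h
    have h' : x ^ (-(1 / η)) = y ^ (-(1 / η)) := mul_left_cancel₀ hD.ne' h
    exact (Real.rpow_left_inj hx.1.le hy.1.le (by simp [hη0.ne'])).1 h'
  have hval : ∀ y ∈ Set.Ioo (0 : ℝ) 1, ENNReal.ofReal |D * (-(1 / η) * y ^ (-(1 / η) - 1))| *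
      (ENNReal.ofReal (D * y ^ (-(1 / η))) * ENNReal.ofReal (shot η a (D * y ^ (-(1 / η))))) =
      ENNReal.ofReal (D ^ 2 * t / η * (y ^ (-(2 / η)) * (1 + t * y)⁻¹)) := by
    intro y hy
    have hy0 := hy.1
    have hy1 : 0 < y ^ (-(1 / η)) := Real.rpow_pos_of_pos hy0 _
    have habs : |D * (-(1 / η) * y ^ (-(1 / η) - 1))| = D * (1 / η * y ^ (-(1 / η) - 1)) := by
      rw [abs_mul, abs_mul, abs_neg, abs_of_pos hD, abs_of_pos (show 0 < 1 / η by positivity),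
        abs_of_pos (Real.rpow_pos_of_pos hy0 _)]
    have hshot : shot η a (D * y ^ (-(1 / η))) = t * y / (1 + t * y) := by
      have h1 : (D * y ^ (-(1 / η))) ^ (-η) = D ^ (-η) * y := by
        rw [Real.mul_rpow hD.le hy1.le, ← Real.rpow_mul hy0.le]
        have : -(1 / η) * -η = 1 := by field_simp
        rw [this, Real.rpow_one]
      rw [shot, h1, ← mul_assoc, ← ht]
    rw [habs, hshot, ← ENNReal.ofReal_mul (by positivity), ← ENNReal.ofReal_mul (by positivity)]
    congr 1
    have h2 : y ^ (-(1 / η) - 1) = y ^ (-(1 / η)) / y := Real.rpow_sub_one hy0.ne' _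
    have h3 : y ^ (-(2 / η)) = y ^ (-(1 / η)) * y ^ (-(1 / η)) := by
      rw [← Real.rpow_add hy0]
      congr 1
      ring
    rw [h2, h3]
    have : 0 < 1 + t * y := by positivity
    field_simp
  have hint : IntegrableOn (fun y : ℝ => y ^ (-(2 / η)) * (1 + t * y)⁻¹) (Set.Ioc 0 1) := by
    have h := (intervalIntegral.intervalIntegrable_rpow' (r := -(2 / η)) (by linarith) (a := 0)
      (b := 1))
    rw [intervalIntegrable_iff_integrableOn_Ioc_of_le zero_le_one] at h
    refine Integrable.mono' h (by fun_prop) ?_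
    filter_upwards [ae_restrict_mem measurableSet_Ioc] with y hy
    have hy0 := hy.1
    rw [norm_mul, Real.norm_of_nonneg (by positivity), Real.norm_of_nonneg (by positivity)]
    refine mul_le_of_le_one_right (by positivity) (inv_le_one_of_one_le₀ ?_)
    have : 0 ≤ t * y := by positivity
    linarith
  rw [← image_rpow_Ioo hη0 hD, lintegral_image_eq_lintegral_abs_deriv_mul measurableSet_Ioo hder hinj,
    setLIntegral_congr_fun measurableSet_Ioo hval, calF_eq hη, restrict_Ioo_eq_restrict_Ioc,
    ← ofReal_integral_eq_lintegral_ofReal (hint.const_mul _), integral_const_mul,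
    intervalIntegral.integral_of_le zero_le_one]
  · congr 1
    ring
  · filter_upwards [ae_restrict_mem measurableSet_Ioc] with y hy
    have hy0 := hy.1
    simp only [Pi.zero_apply]
    positivity

lemma lintegral_shot_outside {η a D : ℝ} (hη : 2 < η) (ha : 0 ≤ a) (hD : 0 < D) :
    ∫⁻ x in {x : Plane | D < ‖x‖}, ENNReal.ofReal (shot η a ‖x‖) =
      ENNReal.ofReal (Real.pi * D ^ 2 * calF (a * D ^ (-η)) η) := by
  have hm : MeasurableSet {x : Plane | D < ‖x‖} := measurableSet_lt measurable_const measurable_norm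
  have h1 : ∀ x : Plane, {x : Plane | D < ‖x‖}.indicator (fun x => ENNReal.ofReal (shot η a ‖x‖)) x =
      (Set.Ioi D).indicator (fun r => ENNReal.ofReal (shot η a r)) ‖x‖ := fun x => rfl
  rw [← lintegral_indicator hm]
  simp_rw [h1]
  rw [lintegral_plane_norm ((measurable_shot η a).ennreal_ofReal.indicator measurableSet_Ioi)]
  have h2 : ∀ r, ENNReal.ofReal r * (Set.Ioi D).indicator (fun r => ENNReal.ofReal (shot η a r)) r =
      (Set.Ioi D).indicator (fun r => ENNReal.ofReal r * ENNReal.ofReal (shot η a r)) r := by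
    intro r
    simp only [Set.indicator]
    split_ifs <;> simp
  simp_rw [h2]
  rw [lintegral_indicator measurableSet_Ioi, Measure.restrict_restrict measurableSet_Ioi,
    Set.inter_eq_left.2 (Set.Ioi_subset_Ioi hD.le), lintegral_shot_Ioi_outer hη ha hD,
    ← ENNReal.ofReal_mul (by positivity)]
  congr 1
  ring

lemma calF_nonneg {η : ℝ} (hη : 2 < η) {t : ℝ} (ht : 0 ≤ t) : 0 ≤ calF t η := by
  have hη0 : 0 < η := by linarith
  rw [calF_eq hη]
  refine mul_nonneg (by positivity) (intervalIntegral.integral_nonneg zero_le_one fun y hy => ?_)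
  have := hy.1
  positivity

/-! ### The Laplace transform of the interference -/

lemma IndepFun.lintegral_eq_lintegral_lintegral {Ω α β : Type*} [MeasurableSpace Ω]
    [MeasurableSpace α] [MeasurableSpace β] {μ : Measure Ω} [IsProbabilityMeasure μ]
    {A : Ω → α} {B : Ω → β} (hA : Measurable A) (hB : Measurable B) (h : IndepFun A B μ)
    {F : α × β → ℝ≥0∞} (hF : Measurable F) :
    ∫⁻ ω, F (A ω, B ω) ∂μ = ∫⁻ ω', ∫⁻ ω, F (A ω, B ω') ∂μ ∂μ := by
  have hprod := (indepFun_iff_map_prod_eq_prod_map_map hA.aemeasurable hB.aemeasurable).1 h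
  have := Measure.isProbabilityMeasure_map hA.aemeasurable (μ := μ)
  have := Measure.isProbabilityMeasure_map hB.aemeasurable (μ := μ)
  rw [← lintegral_map (f := F) hF (hA.prodMk hB), hprod, lintegral_prod_symm _ hF.aemeasurable,
    lintegral_map hF.lintegral_prod_left' hB]
  refine lintegral_congr fun ω' => ?_
  exact lintegral_map (f := fun x => F (x, B ω')) (hF.comp measurable_prodMk_right) hA

lemma lintegral_expNeg_expMeasure {c : ℝ} (hc : 0 ≤ c) :
    ∫⁻ h, expNeg (ENNReal.ofReal (c * h)) ∂(expMeasure 1) = ENNReal.ofReal (1 / (1 + c)) := by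
  have hm : Measurable (gammaPDF 1 1) := (measurable_gammaPDFReal 1 1).ennreal_ofReal
  have hm2 : Measurable fun h : ℝ => expNeg (ENNReal.ofReal (c * h)) :=
    measurable_expNeg.comp (by fun_prop)
  rw [expMeasure, gammaMeasure, lintegral_withDensity_eq_lintegral_mul _ hm hm2,
    ← lintegral_exp_neg_mul (by positivity), restrict_Ioi_eq_restrict_Ici, ← lintegral_indicator measurableSet_Ici]
  refine lintegral_congr fun h => ?_
  simp only [Pi.mul_apply, Set.indicator, Set.mem_Ici, gammaPDF, gammaPDFReal]
  split_ifs with hh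
  · rw [expNeg_ofReal (by positivity), ← ENNReal.ofReal_mul (by positivity)]
    simp only [Real.one_rpow, Real.Gamma_one, div_one, one_mul, sub_self, Real.rpow_zero]
    rw [← Real.exp_add]
    congr 2
    ring
  · simp

lemma shot_lt_one {η a r : ℝ} (ha : 0 ≤ a) (hr : 0 ≤ r) : shot η a r < 1 := by
  unfold shot
  have : 0 ≤ a * r ^ (-η) := by positivity
  rw [div_lt_one (by linarith)]
  linarith

namespace Params

variable {K M : ℕ} (N : Params K M)

/-- The conditional Laplace transform, at `s`, of the power received from an interferer of tier `m`
at distance `r`. -/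
noncomputable def markLaplace (s : ℝ) (m : Fin (M + 1)) (x : Plane) : ℝ :=
  1 - N.ptr m * shot N.η (s * N.P m) ‖x‖

lemma markLaplace_pos {s : ℝ} (hs : 0 ≤ s) (m : Fin (M + 1)) (x : Plane) :
    0 < N.markLaplace s m x := by
  have h0 := shot_nonneg (η := N.η) (mul_nonneg hs (N.P_pos m).le) (norm_nonneg x)
  have h1 := shot_lt_one (η := N.η) (mul_nonneg hs (N.P_pos m).le) (norm_nonneg x)
  have := mul_le_of_le_one_left h0 (N.ptr_le m)
  unfold markLaplace
  linarith

lemma markLaplace_le_one {s : ℝ} (hs : 0 ≤ s) (m : Fin (M + 1)) (x : Plane) :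
    N.markLaplace s m x ≤ 1 := by
  have h0 := shot_nonneg (η := N.η) (mul_nonneg hs (N.P_pos m).le) (norm_nonneg x)
  have := mul_nonneg (N.ptr_nonneg m) h0
  unfold markLaplace
  linarith

lemma measurable_markLaplace (s : ℝ) (m : Fin (M + 1)) : Measurable (N.markLaplace s m) :=
  measurable_const.sub (((measurable_shot _ _).comp measurable_norm).const_mul _)

/-- The exponent of the Laplace transform, at `s`, of the interference from tier `m`. -/
noncomputable def laplaceExponent (s : ℝ) (m : Fin (M + 1)) : ℝ :=
  N.lam m * (N.ptr m * if m = 0 then Real.pi * N.dK ^ 2 * calF (s * N.dK ^ (-N.η)) N.η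
    else Real.pi * (s * N.P m) ^ (2 / N.η) * Real.Gamma (1 + 2 / N.η) * Real.Gamma (1 - 2 / N.η))

/-- The factor by which an interferer contributes to `e^(-s I)`. -/
noncomputable def markFactor (s : ℝ) (m : Fin (M + 1)) (b : Bool) (h : ℝ) (x : Plane) : ℝ≥0∞ :=
  if b then expNeg (ENNReal.ofReal s * ENNReal.ofReal (N.P m * ‖x‖ ^ (-N.η) * h)) else 1

lemma measurable_markFactor (s : ℝ) (m : Fin (M + 1)) :
    Measurable fun z : (Bool × ℝ) × Plane => N.markFactor s m z.1.1 z.1.2 z.2 := by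
  unfold markFactor
  refine Measurable.ite ?_ (measurable_expNeg.comp (by fun_prop)) measurable_const
  exact measurable_fst.comp measurable_fst (measurableSet_singleton true)

end Params

lemma measurable_fun_tsum {Ω : Type*} {mΩ : MeasurableSpace Ω} {f : ℕ → Ω → ℝ≥0∞}
    (h : ∀ i, Measurable (f i)) : Measurable fun ω => ∑' i, f i ω :=
  Measurable.tsum h

section Interference

variable {Ω : Type*} {K M : ℕ} {N : Params K M} {W : Vars Ω K M}

lemma Vars.measurable_interference {S : Set (Source K M)}
    (hX : ∀ m, Source.X m ∈ S) (honI : ∀ m i, Source.onI m i ∈ S) (hHI : ∀ m i, Source.HI m i ∈ S) :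
    Measurable[W.alg S] (N.interference W) := by
  have hg : ∀ m, Measurable fun z : (Bool × ℝ) × Plane =>
      if z.1.1 then ENNReal.ofReal (N.P m * ‖z.2‖ ^ (-N.η) * z.1.2) else 0 := fun m =>
    Measurable.ite (measurable_fst.comp measurable_fst (measurableSet_singleton true))
      (by fun_prop) measurable_const
  have hmark : ∀ m i, Measurable[W.alg S] fun ω => ((W.onI m i ω, W.HI m i ω), W.X m i ω) :=
    fun m i => ((W.measurable_onI (honI m i)).prodMk (W.measurable_HI (hHI m i))).prodMk
      (W.measurable_X (hX m) i)
  exact Finset.measurable_fun_sum _ fun m _ => measurable_fun_tsum fun i => (hg m).comp (hmark m i)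

variable [MeasurableSpace Ω] {μ : Measure Ω}

lemma IsModel.measurable_interference (hW : IsModel N W μ) : Measurable (N.interference W) :=
  (Vars.measurable_interference (S := Set.univ) (fun _ => trivial) (fun _ _ => trivial)
    fun _ _ => trivial).mono (hW.alg_le _) le_rfl

lemma IsModel.iIndepFun_tsum (hW : IsModel N W μ) {f : Fin (M + 1) → Plane → ℝ≥0∞}
    (hf : ∀ m, Measurable (f m)) :
    iIndepFun (fun m ω => ∑' i, f m (W.X m i ω)) μ := by
  have h := hW.indep.precomp (g := fun m => Source.X m) fun m m' h => Source.X.inj h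
  rw [iIndepFun_iff_iIndep]
  refine iIndep_of_iIndep_of_le h fun m => ?_
  refine Measurable.comap_le (m₁ := W.sigmaAlg (Source.X m)) (measurable_fun_tsum fun i => ?_)
  exact (hf m).comp (Measurable.of_comap_le
    (le_iSup (fun i => MeasurableSpace.comap (W.X m i) inferInstance) i))

end Interference

section Laplace

variable {Ω : Type*} [MeasurableSpace Ω] {K M : ℕ} {N : Params K M} {W : Vars Ω K M}
  {μ : Measure Ω} [IsProbabilityMeasure μ]

lemma IsModel.lintegral_markFactor (hW : IsModel N W μ) {s : ℝ} (hs : 0 ≤ s) (m : Fin (M + 1))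
    (i : ℕ) (x : Plane) :
    ∫⁻ ω, N.markFactor s m (W.onI m i ω) (W.HI m i ω) x ∂μ =
      ENNReal.ofReal (N.markLaplace s m x) := by
  have hi : IndepFun (W.onI m i) (W.HI m i) μ :=
    hW.indepFun (S := {Source.onI m i}) (T := {Source.HI m i}) (by simp) (W.measurable_onI rfl)
      (W.measurable_HI rfl)
  have hP := (N.P_pos m).le
  have hc : 0 ≤ s * N.P m * ‖x‖ ^ (-N.η) := by positivity
  have hf : ∀ h, ENNReal.ofReal s * ENNReal.ofReal (N.P m * ‖x‖ ^ (-N.η) * h) =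
      ENNReal.ofReal (s * N.P m * ‖x‖ ^ (-N.η) * h) := by
    intro h
    rw [← ENNReal.ofReal_mul hs]
    congr 1
    ring
  have hm : Measurable fun h : ℝ => expNeg (ENNReal.ofReal (s * N.P m * ‖x‖ ^ (-N.η) * h)) :=
    measurable_expNeg.comp (by fun_prop)
  simp only [Params.markFactor, hf]
  rw [lintegral_gate (hW.meas_onI m i) (hW.meas_HI m i) hi (hW.prob_onI m i) hm,
    (hW.law_HI m i).lintegral_comp hm.aemeasurable, lintegral_expNeg_expMeasure hc,
    ← ENNReal.ofReal_mul (N.ptr_nonneg m), ← ENNReal.ofReal_add]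
  · congr 1
    rw [Params.markLaplace, shot]
    field_simp
    ring
  · linarith [N.ptr_le m]
  · have := N.ptr_nonneg m
    positivity

/-- The sources of the positions of all the interferers, and of the marks of those in `J`. -/
def positionsAndMarks {K M : ℕ} (J : Finset (Fin (M + 1) × ℕ)) : Set (Source K M) :=
  {y | (∃ m, y = Source.X m) ∨ ∃ j ∈ J, y = Source.onI j.1 j.2 ∨ y = Source.HI j.1 j.2}

/-- The positions within a tier form a single source, so only the marks can be averaged separately.
Each step freezes all positions and the remaining marks and integrates one mark out. The averaged
factor depends on positions only and is absorbed into `Y`, hence the induction over all such `Y`. -/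
lemma IsModel.lintegral_mul_prod_markFactor (hW : IsModel N W μ) {s : ℝ} (hs : 0 ≤ s)
    (J : Finset (Fin (M + 1) × ℕ)) {Y : Ω → ℝ≥0∞}
    (hY : Measurable[W.alg (positionsAndMarks ∅)] Y) :
    ∫⁻ ω, Y ω * ∏ j ∈ J, N.markFactor s j.1 (W.onI j.1 j.2 ω) (W.HI j.1 j.2 ω) (W.X j.1 j.2 ω) ∂μ =
      ∫⁻ ω, Y ω * ∏ j ∈ J, ENNReal.ofReal (N.markLaplace s j.1 (W.X j.1 j.2 ω)) ∂μ := by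
  induction J using Finset.induction_on generalizing Y with
  | empty => simp
  | insert j J hj ih =>
    have hX : ∀ (J : Finset (Fin (M + 1) × ℕ)) (j : Fin (M + 1) × ℕ),
        Measurable[W.alg (positionsAndMarks J)] (W.X j.1 j.2) := fun J j =>
      W.measurable_X (S := positionsAndMarks J) (Or.inl ⟨j.1, rfl⟩) j.2
    let V : Ω → ℝ≥0∞ := fun ω => Y ω *
      ∏ j ∈ J, N.markFactor s j.1 (W.onI j.1 j.2 ω) (W.HI j.1 j.2 ω) (W.X j.1 j.2 ω)
    have hV : Measurable[W.alg (positionsAndMarks J)] V := by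
      have hsub : (positionsAndMarks ∅ : Set (Source K M)) ⊆ positionsAndMarks J := by
        rintro y (h | ⟨j, hj, -⟩)
        · exact Or.inl h
        · simp at hj
      refine Measurable.mul (hY.mono (W.alg_mono hsub) le_rfl)
        (Finset.measurable_fun_prod _ fun i hi => ?_)
      have h1 : Measurable[W.alg (positionsAndMarks J)] (W.onI i.1 i.2) :=
        W.measurable_onI (S := positionsAndMarks J) (Or.inr ⟨i, hi, Or.inl rfl⟩)
      have h2 : Measurable[W.alg (positionsAndMarks J)] (W.HI i.1 i.2) :=
        W.measurable_HI (S := positionsAndMarks J) (Or.inr ⟨i, hi, Or.inr rfl⟩)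
      exact (N.measurable_markFactor s i.1).comp ((h1.prodMk h2).prodMk (hX J i))
    have hA : Measurable[W.alg {Source.onI j.1 j.2, Source.HI j.1 j.2}]
        fun ω => (W.onI j.1 j.2 ω, W.HI j.1 j.2 ω) :=
      (W.measurable_onI (by simp)).prodMk (W.measurable_HI (by simp))
    have hB : Measurable[W.alg (positionsAndMarks J)] fun ω => (V ω, W.X j.1 j.2 ω) :=
      hV.prodMk (hX J j)
    have hd : Disjoint ({Source.onI j.1 j.2, Source.HI j.1 j.2} : Set (Source K M))
        (positionsAndMarks J) := by
      rw [Set.disjoint_left]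
      rintro y (rfl | rfl) (⟨m, h⟩ | ⟨i, hi, h | h⟩) <;>
        try simp only [reduceCtorEq] at h
      · obtain ⟨h1, h2⟩ := Source.onI.inj h
        exact hj (Prod.ext h1 h2 ▸ hi)
      · obtain ⟨h1, h2⟩ := Source.HI.inj h
        exact hj (Prod.ext h1 h2 ▸ hi)
    have hind := hW.indepFun hd hA hB
    have hF : Measurable fun z : (Bool × ℝ) × (ℝ≥0∞ × Plane) =>
        z.2.1 * N.markFactor s j.1 z.1.1 z.1.2 z.2.2 :=
      (measurable_fst.comp measurable_snd).mul ((N.measurable_markFactor s j.1).comp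
        (measurable_fst.prodMk (measurable_snd.comp measurable_snd)))
    have hstep := IndepFun.lintegral_eq_lintegral_lintegral (hA.mono (hW.alg_le _) le_rfl)
      (hB.mono (hW.alg_le _) le_rfl) hind hF
    have hinner : ∀ ω', ∫⁻ ω, V ω' * N.markFactor s j.1 (W.onI j.1 j.2 ω) (W.HI j.1 j.2 ω)
        (W.X j.1 j.2 ω') ∂μ = V ω' * ENNReal.ofReal (N.markLaplace s j.1 (W.X j.1 j.2 ω')) := by
      intro ω'
      rw [lintegral_const_mul, hW.lintegral_markFactor hs]
      exact ((N.measurable_markFactor s j.1).comp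
        (measurable_id.prodMk measurable_const)).comp (hA.mono (hW.alg_le _) le_rfl)
    simp only [hinner] at hstep
    have hY' : Measurable[W.alg (positionsAndMarks ∅)] fun ω =>
        Y ω * ENNReal.ofReal (N.markLaplace s j.1 (W.X j.1 j.2 ω)) :=
      hY.mul ((N.measurable_markLaplace s j.1).ennreal_ofReal.comp (hX ∅ j))
    have hih := ih hY'
    calc _ = ∫⁻ ω, V ω * N.markFactor s j.1 (W.onI j.1 j.2 ω) (W.HI j.1 j.2 ω)
            (W.X j.1 j.2 ω) ∂μ := by
          refine lintegral_congr fun ω => ?_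
          rw [Finset.prod_insert hj]
          ring
      _ = _ := hstep
      _ = ∫⁻ ω, Y ω * ENNReal.ofReal (N.markLaplace s j.1 (W.X j.1 j.2 ω)) *
            ∏ j ∈ J, N.markFactor s j.1 (W.onI j.1 j.2 ω) (W.HI j.1 j.2 ω) (W.X j.1 j.2 ω) ∂μ := by
          refine lintegral_congr fun ω => ?_
          ring
      _ = _ := hih
      _ = _ := by
          refine lintegral_congr fun ω => ?_
          rw [Finset.prod_insert hj]
          ring

/-- Writing the factor, which lies in `(0, 1]`, as an exponential turns the product over the points
into the form required by `IsPoissonProcess.laplace`. -/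
lemma ofReal_markLaplace_eq_expNeg {s : ℝ} (hs : 0 ≤ s) (m : Fin (M + 1)) (x : Plane) :
    ENNReal.ofReal (N.markLaplace s m x) =
      expNeg (ENNReal.ofReal (-Real.log (N.markLaplace s m x))) := by
  have h0 := N.markLaplace_pos hs m x
  rw [expNeg_ofReal, neg_neg, Real.exp_log h0]
  exact neg_nonneg.2 (Real.log_nonpos h0.le (N.markLaplace_le_one hs m x))

lemma lintegral_one_sub_markLaplace {s : ℝ} (hs : 0 ≤ s) (m : Fin (M + 1)) :
    ∫⁻ x, (1 - ENNReal.ofReal (N.markLaplace s m x))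
        ∂(ENNReal.ofReal (N.lam m) • volume.restrict (N.region m)) =
      ENNReal.ofReal (N.laplaceExponent s m) := by
  have h1 : ∀ x, 1 - ENNReal.ofReal (N.markLaplace s m x) =
      ENNReal.ofReal (N.ptr m) * ENNReal.ofReal (shot N.η (s * N.P m) ‖x‖) := by
    intro x
    rw [← ENNReal.ofReal_one, ← ENNReal.ofReal_sub _ (N.markLaplace_pos hs m x).le,
      ← ENNReal.ofReal_mul (N.ptr_nonneg m), Params.markLaplace]
    congr 1
    ring
  have hP := (N.P_pos m).le
  simp only [h1]
  have hm : Measurable fun x : Plane => ENNReal.ofReal (shot N.η (s * N.P m) ‖x‖) :=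
    ((measurable_shot _ _).comp measurable_norm).ennreal_ofReal
  rw [lintegral_smul_measure, lintegral_const_mul _ hm, Params.laplaceExponent,
    ENNReal.ofReal_mul (N.lam_pos m).le, ENNReal.ofReal_mul (N.ptr_nonneg m), smul_eq_mul]
  congr 2
  unfold Params.region
  split_ifs with hm
  · subst hm
    rw [N.P_zero, mul_one, lintegral_shot_outside N.η_gt hs N.dK_pos]
  · rw [Measure.restrict_univ, lintegral_shot_plane N.η_gt (mul_nonneg hs hP)]

lemma laplaceExponent_nonneg {s : ℝ} (hs : 0 ≤ s) (m : Fin (M + 1)) :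
    0 ≤ N.laplaceExponent s m := by
  have hP := (N.P_pos m).le
  have hη := N.η_pos
  have h2 : 2 / N.η < 1 := by rw [div_lt_one hη]; exact N.η_gt
  have hG1 : 0 < Real.Gamma (1 + 2 / N.η) := Real.Gamma_pos_of_pos (by positivity)
  have hG2 : 0 < Real.Gamma (1 - 2 / N.η) := Real.Gamma_pos_of_pos (by linarith)
  have hd := N.dK_pos
  have hc := calF_nonneg N.η_gt (t := s * N.dK ^ (-N.η)) (by positivity)
  have hl := N.lam_pos m
  have hp := N.ptr_nonneg m
  unfold Params.laplaceExponent
  split_ifs <;> positivity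

/-- The Laplace transform of the interference. -/
theorem IsModel.laplace_interference (hW : IsModel N W μ) {s : ℝ} (hs : 0 ≤ s) :
    ∫⁻ ω, expNeg (ENNReal.ofReal s * N.interference W ω) ∂μ =
      ENNReal.ofReal (Real.exp (-∑ m, N.laplaceExponent s m)) := by
  let f : Fin (M + 1) → Plane → ℝ≥0∞ := fun m x => ENNReal.ofReal (-Real.log (N.markLaplace s m x))
  have hf : ∀ m, Measurable (f m) := fun m =>
    (Real.measurable_log.comp (N.measurable_markLaplace s m)).neg.ennreal_ofReal
  have hfg : ∀ m x, ENNReal.ofReal (N.markLaplace s m x) = expNeg (f m x) := fun m x =>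
    ofReal_markLaplace_eq_expNeg hs m x
  have hXm : ∀ m i, Measurable (W.X m i) := fun m => (hW.poisson m).measurable
  let e : Fin (M + 1) → ℕ → Ω → ℝ≥0∞ := fun m i ω =>
    N.markFactor s m (W.onI m i ω) (W.HI m i ω) (W.X m i ω)
  have hem : ∀ m i, Measurable (e m i) := fun m i =>
    (N.measurable_markFactor s m).comp
      (((hW.meas_onI m i).prodMk (hW.meas_HI m i)).prodMk (hXm m i))
  have he : ∀ m i ω, e m i ω = expNeg (ENNReal.ofReal s * if W.onI m i ω then
      ENNReal.ofReal (N.P m * ‖W.X m i ω‖ ^ (-N.η) * W.HI m i ω) else 0) := by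
    intro m i ω
    simp only [e, Params.markFactor]
    split_ifs <;> simp
  have hle : ∀ (n : ℕ) (a : Fin (M + 1) → ℕ → ℝ≥0∞),
      ∏ m, ∏ i ∈ Finset.range n, expNeg (a m i) ≤ 1 := fun n a =>
    Finset.prod_le_one' fun m _ => Finset.prod_le_one' fun i _ => expNeg_le_one _
  have hlim : ∀ a : Fin (M + 1) → ℕ → ℝ≥0∞, Filter.Tendsto
      (fun n => ∏ m, ∏ i ∈ Finset.range n, expNeg (a m i)) Filter.atTop
      (nhds (∏ m, expNeg (∑' i, a m i))) := by
    intro a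
    simp only [← expNeg_sum]
    refine (continuous_expNeg.tendsto _).comp (tendsto_finsetSum _ fun m _ => ?_)
    exact ENNReal.tendsto_nat_tsum (a m)
  -- Marks can be averaged for finitely many interferers at a time; the full sums are recovered on
  -- both sides by dominated convergence with bound `1`.
  have hL : Filter.Tendsto (fun n => ∫⁻ ω, ∏ m, ∏ i ∈ Finset.range n, e m i ω ∂μ) Filter.atTop
      (nhds (∫⁻ ω, expNeg (ENNReal.ofReal s * N.interference W ω) ∂μ)) := by
    refine tendsto_lintegral_of_dominated_convergence (fun _ => 1) (fun n => ?_) (fun n => ?_)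
      (by simp) (ae_of_all _ fun ω => ?_)
    · exact Finset.measurable_fun_prod _ fun m _ => Finset.measurable_fun_prod _ fun i _ => hem m i
    · refine ae_of_all _ fun ω => ?_
      simp only [he]
      exact hle n _
    · simp only [he, Params.interference, Finset.mul_sum, ← ENNReal.tsum_mul_left, expNeg_sum]
      exact hlim _
  have hR : Filter.Tendsto (fun n => ∫⁻ ω, ∏ m, ∏ i ∈ Finset.range n, expNeg (f m (W.X m i ω)) ∂μ)
      Filter.atTop (nhds (∫⁻ ω, ∏ m, expNeg (∑' i, f m (W.X m i ω)) ∂μ)) := by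
    refine tendsto_lintegral_of_dominated_convergence (fun _ => 1) (fun n => ?_) (fun n => ?_)
      (by simp) (ae_of_all _ fun ω => hlim _)
    · exact Finset.measurable_fun_prod _ fun m _ => Finset.measurable_fun_prod _ fun i _ =>
        measurable_expNeg.comp ((hf m).comp (hXm m i))
    · exact ae_of_all _ fun ω => hle n _
  have heq : ∀ n : ℕ, ∫⁻ ω, ∏ m, ∏ i ∈ Finset.range n, e m i ω ∂μ =
      ∫⁻ ω, ∏ m, ∏ i ∈ Finset.range n, expNeg (f m (W.X m i ω)) ∂μ := by
    intro n
    have h := hW.lintegral_mul_prod_markFactor hs (Finset.univ ×ˢ Finset.range n)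
      (Y := fun _ => 1) measurable_const
    simpa only [one_mul, Finset.prod_product, hfg] using h
  rw [tendsto_nhds_unique hL ((Filter.tendsto_congr heq).2 hR),
    lintegral_prod_eq_prod_lintegral_of_indepFun _ (fun m ω => expNeg (∑' i, f m (W.X m i ω)))
      ((hW.iIndepFun_tsum hf).comp (fun _ => expNeg) fun _ => measurable_expNeg)
      fun m => measurable_expNeg.comp ((hW.poisson m).measurable_tsum (hf m)),
    ← expNeg_ofReal (Finset.sum_nonneg fun m _ => laplaceExponent_nonneg hs m),
    ENNReal.ofReal_sum_of_nonneg fun m _ => laplaceExponent_nonneg hs m, expNeg_sum]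
  refine Finset.prod_congr rfl fun m _ => ?_
  have : SigmaFinite (ENNReal.ofReal (N.lam m) • volume.restrict (N.region m) : Measure Plane) :=
    inferInstanceAs (SigmaFinite ((N.lam m).toNNReal • volume.restrict (N.region m)))
  rw [(hW.poisson m).laplace (hf m), ← lintegral_one_sub_markLaplace hs m]
  simp only [hfg]

/-- For tier `0` the integral outside the disc is at most the one over the whole plane. This gives
every exponent the order `s^(2/η)`, so all of them vanish as `s → 0`. -/
lemma laplaceExponent_le {s : ℝ} (hs : 0 ≤ s) (m : Fin (M + 1)) :
    N.laplaceExponent s m ≤ s ^ (2 / N.η) * (N.lam m * (N.ptr m * (Real.pi * N.P m ^ (2 / N.η) *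
      Real.Gamma (1 + 2 / N.η) * Real.Gamma (1 - 2 / N.η)))) := by
  have hP := (N.P_pos m).le
  have hle : (if m = 0 then Real.pi * N.dK ^ 2 * calF (s * N.dK ^ (-N.η)) N.η
      else Real.pi * (s * N.P m) ^ (2 / N.η) * Real.Gamma (1 + 2 / N.η) *
        Real.Gamma (1 - 2 / N.η)) ≤ Real.pi * (s * N.P m) ^ (2 / N.η) *
          Real.Gamma (1 + 2 / N.η) * Real.Gamma (1 - 2 / N.η) := by
    split_ifs with hm
    · subst hm
      have hη := N.η_pos
      have h2 : 2 / N.η < 1 := by rw [div_lt_one hη]; exact N.η_gt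
      have hG1 : 0 < Real.Gamma (1 + 2 / N.η) := Real.Gamma_pos_of_pos (by positivity)
      have hG2 : 0 < Real.Gamma (1 - 2 / N.η) := Real.Gamma_pos_of_pos (by linarith)
      rw [← ENNReal.ofReal_le_ofReal_iff (by positivity), ← lintegral_shot_outside N.η_gt hs N.dK_pos,
        ← lintegral_shot_plane N.η_gt (mul_nonneg hs hP), N.P_zero, mul_one]
      exact lintegral_mono' Measure.restrict_le_self le_rfl
    · exact le_rfl
  calc N.laplaceExponent s m ≤ N.lam m * (N.ptr m * (Real.pi * (s * N.P m) ^ (2 / N.η) *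
          Real.Gamma (1 + 2 / N.η) * Real.Gamma (1 - 2 / N.η))) :=
        mul_le_mul_of_nonneg_left (mul_le_mul_of_nonneg_left hle (N.ptr_nonneg m)) (N.lam_pos m).le
    _ = _ := by
        rw [Real.mul_rpow hs hP]
        ring

/-- For `s > 0` the variable `e^(-sI)` is at most the indicator of `I < ∞`, so that event has
probability at least `e^(-c s^(2/η))`, which tends to `1` as `s → 0`. -/
theorem IsModel.interference_lt_top (hW : IsModel N W μ) : ∀ᵐ ω ∂μ, N.interference W ω < ∞ := by
  have hI := hW.measurable_interference
  have hm : MeasurableSet {ω | N.interference W ω < ∞} := measurableSet_lt hI measurable_const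
  set c : ℝ := ∑ m, N.lam m * (N.ptr m * (Real.pi * N.P m ^ (2 / N.η) *
      Real.Gamma (1 + 2 / N.η) * Real.Gamma (1 - 2 / N.η))) with hc
  have hbound : ∀ s : ℝ, 0 < s →
      ENNReal.ofReal (Real.exp (-(s ^ (2 / N.η) * c))) ≤ μ {ω | N.interference W ω < ∞} := by
    intro s hs
    calc ENNReal.ofReal (Real.exp (-(s ^ (2 / N.η) * c)))
        ≤ ENNReal.ofReal (Real.exp (-∑ m, N.laplaceExponent s m)) := by
          refine ENNReal.ofReal_le_ofReal (Real.exp_le_exp.2 (neg_le_neg ?_))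
          rw [hc, Finset.mul_sum]
          exact Finset.sum_le_sum fun m _ => laplaceExponent_le hs.le m
      _ = ∫⁻ ω, expNeg (ENNReal.ofReal s * N.interference W ω) ∂μ :=
          (hW.laplace_interference hs.le).symm
      _ ≤ ∫⁻ ω, {ω | N.interference W ω < ∞}.indicator (fun _ => 1) ω ∂μ := by
          refine lintegral_mono fun ω => ?_
          by_cases h : N.interference W ω < ∞
          · rw [Set.indicator_of_mem (by exact h)]
            exact expNeg_le_one _
          · rw [not_lt_top_iff.1 h, ENNReal.mul_top (by simpa using hs), expNeg_top]
            exact zero_le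
      _ = μ {ω | N.interference W ω < ∞} := by
          rw [lintegral_indicator_const hm, one_mul]
  have hlim : Filter.Tendsto (fun s : ℝ => ENNReal.ofReal (Real.exp (-(s ^ (2 / N.η) * c))))
      (nhdsWithin 0 (Set.Ioi 0)) (nhds 1) := by
    have h0 : Filter.Tendsto (fun s : ℝ => s ^ (2 / N.η)) (nhdsWithin 0 (Set.Ioi 0)) (nhds 0) := by
      have hη := N.η_pos
      have h := (Real.continuousAt_rpow_const 0 (2 / N.η) (Or.inr (by positivity))).tendsto
      rw [Real.zero_rpow (by positivity)] at h
      exact h.mono_left nhdsWithin_le_nhds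
    have h1 := ENNReal.tendsto_ofReal ((Real.continuous_exp.tendsto _).comp ((h0.mul_const c).neg))
    simpa [Function.comp_def] using h1
  have hge : 1 ≤ μ {ω | N.interference W ω < ∞} :=
    le_of_tendsto hlim (by
      filter_upwards [self_mem_nhdsWithin] with s hs
      exact hbound s hs)
  exact (prob_compl_eq_zero_iff hm).2 (le_antisymm prob_le_one hge)

end Laplace

/-! ### The coverage probability -/

section Coverage

variable {Ω : Type*} {K M : ℕ} {N : Params K M} {W : Vars Ω K M}

lemma Params.load_nonneg {δ θ : ℝ} (hδ : 0 ≤ δ) (hθ : 0 ≤ θ) (ω : Ω) : 0 ≤ N.load W δ θ ω := by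
  have h1 := N.dK_pos
  have h2 := N.noise_nonneg
  unfold Params.load
  positivity

lemma Params.signal_eq (ω : Ω) : N.signal W ω = N.dK ^ (-N.η) * N.normSignal W ω := by
  have hd := N.dK_pos
  have hne : N.dK ^ (-N.η) ≠ 0 := (Real.rpow_pos_of_pos hd _).ne'
  rw [Params.signal, Params.normSignal, Finset.mul_sum]
  refine Finset.sum_congr rfl fun i _ => ?_
  split_ifs
  · rw [Params.nd, Real.div_rpow (N.d_pos i).le hd.le]
    field_simp
  · simp

/-- Division in `[0, ∞]` makes this correct even for a zero denominator: both sides then say that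
the signal is positive. Truncation of the signal by `ENNReal.ofReal` is harmless since the threshold
is nonnegative. -/
lemma Params.ofReal_lt_sinr_iff {θ : ℝ} (hθ : 0 ≤ θ) {ω : Ω} (hI : N.interference W ω < ∞) :
    ENNReal.ofReal θ < N.sinr W ω ↔
      N.dK ^ N.η * θ * ((N.interference W ω).toReal + N.noise) < N.normSignal W ω := by
  have hn := N.noise_nonneg
  have hd := Real.rpow_pos_of_pos N.dK_pos N.η
  have hD : N.interference W ω + ENNReal.ofReal N.noise =
      ENNReal.ofReal ((N.interference W ω).toReal + N.noise) := by
    rw [ENNReal.ofReal_add ENNReal.toReal_nonneg hn, ENNReal.ofReal_toReal hI.ne]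
  rw [Params.sinr, hD, ENNReal.lt_div_iff_mul_lt (Or.inr ENNReal.ofReal_ne_top)
      (Or.inl ENNReal.ofReal_ne_top),
    ← ENNReal.ofReal_mul hθ, ENNReal.ofReal_lt_ofReal_iff_of_nonneg (by positivity),
    Params.signal_eq, Real.rpow_neg N.dK_pos.le, inv_mul_eq_div, lt_div_iff₀ hd]
  rw [show θ * ((N.interference W ω).toReal + N.noise) * N.dK ^ N.η =
    N.dK ^ N.η * θ * ((N.interference W ω).toReal + N.noise) by ring]

variable [MeasurableSpace Ω] {μ : Measure Ω}

lemma IsModel.measurable_load (hW : IsModel N W μ) (δ θ : ℝ) : Measurable (N.load W δ θ) :=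
  (hW.measurable_interference.ennreal_toReal.add_const _).const_mul _

lemma IsModel.measurable_gammaQ_load (hW : IsModel N W μ) {δ θ : ℝ} (hδ : 0 ≤ δ) (hθ : 0 ≤ θ)
    {v : ℕ} (hv : 1 ≤ v) : Measurable fun ω => gammaQ v (N.load W δ θ ω) := by
  -- Continuity of `gammaQ` is available on `[0, ∞)` only; the load takes its values there, so the
  -- clamp changes nothing.
  have hc : Continuous fun x : ℝ => gammaQ v (max x 0) :=
    (continuousOn_gammaQ (by exact_mod_cast hv)).comp_continuous (by fun_prop)
      fun x => le_max_right x 0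
  convert hc.measurable.comp (hW.measurable_load δ θ) using 2 with ω
  rw [Function.comp_apply, max_eq_left (Params.load_nonneg hδ hθ ω)]

variable [IsProbabilityMeasure μ]

lemma IsModel.integrable_gammaQ_load (hW : IsModel N W μ) {δ θ : ℝ} (hδ : 0 ≤ δ) (hθ : 0 ≤ θ)
    {v : ℕ} (hv : 1 ≤ v) : Integrable (fun ω => gammaQ v (N.load W δ θ ω)) μ := by
  have hv0 : (0 : ℝ) < v := by exact_mod_cast hv
  refine Integrable.of_bound (hW.measurable_gammaQ_load hδ hθ hv).aestronglyMeasurable 1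
    (ae_of_all _ fun ω => ?_)
  have hl := Params.load_nonneg (N := N) (W := W) hδ hθ ω
  rw [Real.norm_of_nonneg (gammaQ_nonneg hv0 hl)]
  exact gammaQ_le_one hv0 hl

lemma IsModel.integrable_alzer_load (hW : IsModel N W μ) {δ θ : ℝ} (hδ : 0 ≤ δ) (hθ : 0 ≤ θ)
    (v : ℕ) : Integrable (fun ω => alzer v (N.load W δ θ ω)) μ := by
  refine Integrable.of_bound
    ((continuous_alzer v).measurable.comp (hW.measurable_load δ θ)).aestronglyMeasurable 1
    (ae_of_all _ fun ω => ?_)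
  have hl := Params.load_nonneg (N := N) (W := W) hδ hθ ω
  rw [Real.norm_of_nonneg (alzer_nonneg hl)]
  exact alzer_le_one hl

lemma IsModel.integral_exp_neg_interference (hW : IsModel N W μ) {s : ℝ} (hs : 0 ≤ s) :
    ∫ ω, Real.exp (-(s * (N.interference W ω).toReal)) ∂μ =
      Real.exp (-∑ m, N.laplaceExponent s m) := by
  -- Only almost everywhere: `toReal` sends `∞` to `0`, where the two exponentials can disagree.
  have hae : ∀ᵐ ω ∂μ, ENNReal.ofReal (Real.exp (-(s * (N.interference W ω).toReal))) =
      expNeg (ENNReal.ofReal s * N.interference W ω) := by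
    filter_upwards [hW.interference_lt_top] with ω hω
    rw [expNeg_eq_ofReal (ENNReal.mul_ne_top ENNReal.ofReal_ne_top hω.ne), ENNReal.toReal_mul,
      ENNReal.toReal_ofReal hs]
  have hm : Measurable fun ω => Real.exp (-(s * (N.interference W ω).toReal)) :=
    (hW.measurable_interference.ennreal_toReal.const_mul s).neg.exp
  rw [integral_eq_lintegral_of_nonneg_ae (ae_of_all _ fun _ => (Real.exp_pos _).le)
    hm.aestronglyMeasurable, lintegral_congr_ae hae, hW.laplace_interference hs,
    ENNReal.toReal_ofReal (Real.exp_pos _).le]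

lemma IsModel.integral_exp_neg_load (hW : IsModel N W μ) {δ θ : ℝ} (hδ : 0 ≤ δ) (hθ : 0 ≤ θ)
    (v l : ℕ) :
    ∫ ω, Real.exp (-(kappa v * l * N.load W δ θ ω)) ∂μ = N.Delta δ v l θ := by
  have hk := kappa_pos v
  have hd := N.dK_pos
  have hη := N.η_pos
  -- This is the coefficient of `I` in the exponent. Multiplied by `d_K^(-η)` it becomes the
  -- argument of `calF`; raised to the power `2/η` it releases the factor `δ² d_K²` of `Psi`.
  set s : ℝ := (N.dK * δ) ^ N.η * (θ * kappa v * l) with hs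
  have hs0 : 0 ≤ s := by positivity
  have hload : ∀ ω, Real.exp (-(kappa v * l * N.load W δ θ ω)) =
      Real.exp (-(s * N.noise)) * Real.exp (-(s * (N.interference W ω).toReal)) := by
    intro ω
    rw [← Real.exp_add, Params.load, hs, Real.mul_rpow hd.le hδ]
    congr 1
    ring
  have hzero : N.laplaceExponent s 0 = Real.pi * N.ptr 0 * N.lam 0 * N.dK ^ 2 *
      calF (δ ^ N.η * θ * kappa v * l) N.η := by
    have harg : s * N.dK ^ (-N.η) = δ ^ N.η * θ * kappa v * l := by
      have hne : N.dK ^ N.η ≠ 0 := (Real.rpow_pos_of_pos hd _).ne'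
      rw [hs, Real.mul_rpow hd.le hδ, Real.rpow_neg hd.le]
      field_simp
    rw [Params.laplaceExponent, if_pos rfl, harg]
    ring
  have hsucc : ∀ m : Fin M, N.laplaceExponent s m.succ =
      Real.pi * N.ptr m.succ * N.lam m.succ * δ ^ 2 * N.dK ^ 2 *
        (θ * kappa v * l * N.P m.succ) ^ (2 / N.η) *
          Real.Gamma (1 + 2 / N.η) * Real.Gamma (1 - 2 / N.η) := by
    intro m
    have hP := (N.P_pos m.succ).le
    have hpow : (s * N.P m.succ) ^ (2 / N.η) =
        δ ^ 2 * N.dK ^ 2 * (θ * kappa v * l * N.P m.succ) ^ (2 / N.η) := by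
      rw [hs, mul_assoc, Real.mul_rpow (by positivity) (by positivity),
        ← Real.rpow_mul (by positivity), mul_div_cancel₀ _ hη.ne', Real.rpow_two]
      ring
    rw [Params.laplaceExponent, if_neg (Fin.succ_ne_zero m), hpow]
    ring
  simp only [hload]
  rw [integral_const_mul, hW.integral_exp_neg_interference hs0, Fin.sum_univ_succ, neg_add,
    Real.exp_add, hzero, Params.Delta, Params.Psi, ← Real.exp_sum, Finset.sum_neg_distrib,
    ← mul_assoc]
  simp only [hsucc]
  congr 3
  rw [hs]
  ring_nf

lemma IsModel.integral_alzer_load (hW : IsModel N W μ) {δ θ : ℝ} (hδ : 0 ≤ δ) (hθ : 0 ≤ θ)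
    (v : ℕ) : ∫ ω, alzer v (N.load W δ θ ω) ∂μ = N.B δ v θ := by
  have hk := kappa_pos v
  simp only [alzer_eq_sum]
  rw [integral_finsetSum, Params.B]
  · refine Finset.sum_congr rfl fun l _ => ?_
    rw [integral_const_mul, hW.integral_exp_neg_load hδ hθ]
  · intro l _
    refine Integrable.const_mul (Integrable.of_bound
      ((hW.measurable_load δ θ).const_mul _).neg.exp.aestronglyMeasurable 1
      (ae_of_all _ fun ω => ?_)) _
    have hl := Params.load_nonneg (N := N) (W := W) hδ hθ ω
    rw [Real.norm_of_nonneg (Real.exp_pos _).le, Real.exp_le_one_iff]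
    exact neg_nonpos.2 (by positivity)

/-- The complementary distribution function of the SINR as a mixture of the complementary
distribution function of the normalized signal. -/
lemma IsModel.ccdf_eq_integral (hW : IsModel N W μ) {θ : ℝ} (hθ : 0 ≤ θ) :
    N.ccdf W μ θ = ∫ ω', μ.real {ω | N.dK ^ N.η * θ * ((N.interference W ω').toReal + N.noise) <
      N.normSignal W ω} ∂μ := by
  let D : Set (ℝ × ℝ≥0∞) := {z | N.dK ^ N.η * θ * (z.2.toReal + N.noise) < z.1}
  have hD : MeasurableSet D :=
    measurableSet_lt (((measurable_snd.ennreal_toReal).add_const _).const_mul _) measurable_fst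
  have hF : Measurable (D.indicator fun _ => (1 : ℝ≥0∞)) := measurable_const.indicator hD
  have hS := hW.measurable_normSignal
  have hI := hW.measurable_interference
  let T : Set (Source K M) := {y | (∃ i, y = Source.on i) ∨ ∃ i, y = Source.H i}
  have hind : IndepFun (N.normSignal W) (N.interference W) μ :=
    hW.indepFun (S := T) (T := Tᶜ) disjoint_compl_right
      (W.measurable_normSignal (fun i => Or.inl ⟨i, rfl⟩) fun i => Or.inr ⟨i, rfl⟩)
      (Vars.measurable_interference (by simp [T]) (by simp [T]) (by simp [T]))
  have hsec : ∀ ω', ∫⁻ ω, D.indicator (fun _ => 1) (N.normSignal W ω, N.interference W ω') ∂μ =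
      μ {ω | N.dK ^ N.η * θ * ((N.interference W ω').toReal + N.noise) < N.normSignal W ω} :=
    fun ω' => lintegral_indicator_one (μ := μ) (s := {ω | N.dK ^ N.η * θ *
      ((N.interference W ω').toReal + N.noise) < N.normSignal W ω})
      (measurableSet_lt measurable_const hS)
  have hdiag : ∫⁻ ω, D.indicator (fun _ => 1) (N.normSignal W ω, N.interference W ω) ∂μ =
      μ {ω | ENNReal.ofReal θ < N.sinr W ω} := by
    have h : ∫⁻ ω, D.indicator (fun _ => 1) (N.normSignal W ω, N.interference W ω) ∂μ =
        μ ((fun ω => (N.normSignal W ω, N.interference W ω)) ⁻¹' D) :=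
      lintegral_indicator_one (hD.preimage (hS.prodMk hI))
    rw [h]
    refine measure_congr ?_
    filter_upwards [hW.interference_lt_top] with ω hω
    exact propext (Params.ofReal_lt_sinr_iff hθ hω).symm
  have hswap := IndepFun.lintegral_eq_lintegral_lintegral hS hI hind hF
  have hmeas : Measurable fun ω' =>
      μ {ω | N.dK ^ N.η * θ * ((N.interference W ω').toReal + N.noise) < N.normSignal W ω} := by
    have h := (hF.comp ((hS.comp measurable_fst).prodMk
      (hI.comp measurable_snd))).lintegral_prod_left' (μ := μ)
    simpa only [Function.comp_apply, hsec] using h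
  rw [hdiag] at hswap
  simp only [hsec] at hswap
  simp only [Params.ccdf, measureReal_def]
  rw [hswap, integral_toReal hmeas.aemeasurable (ae_of_all _ fun _ => measure_lt_top _ _)]

theorem IsModel.ccdf_eq (hW : IsModel N W μ) {θ : ℝ} (hθ : 0 ≤ θ) :
    N.ccdf W μ θ = N.G * ∑ δ ∈ N.deltas, ∑ v ∈ Finset.Icc 1 (N.mult δ),
      N.coeff δ v * ∫ ω, gammaQ v (N.load W δ θ ω) ∂μ := by
  have hn := N.noise_nonneg
  have hd := N.dK_pos
  have hcond : ∀ ω', μ.real {ω | N.dK ^ N.η * θ * ((N.interference W ω').toReal + N.noise) <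
      N.normSignal W ω} = N.G * ∑ δ ∈ N.deltas, ∑ v ∈ Finset.Icc 1 (N.mult δ),
        N.coeff δ v * gammaQ v (N.load W δ θ ω') := by
    intro ω'
    rw [hW.ccdf_normSignal (by positivity)]
    simp only [Params.load, ← mul_assoc]
  have hint : ∀ δ ∈ N.deltas, ∀ v ∈ Finset.Icc 1 (N.mult δ),
      Integrable (fun ω => N.coeff δ v * gammaQ v (N.load W δ θ ω)) μ := fun δ hδ v hv =>
    (hW.integrable_gammaQ_load (N.pos_of_mem_deltas hδ).le hθ (Finset.mem_Icc.1 hv).1).const_mul _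
  rw [hW.ccdf_eq_integral hθ]
  simp only [hcond]
  rw [integral_const_mul, integral_finsetSum _ fun δ hδ => integrable_finsetSum _ (hint δ hδ)]
  congr 1
  refine Finset.sum_congr rfl fun δ hδ => ?_
  rw [integral_finsetSum _ (hint δ hδ)]
  simp only [integral_const_mul]

/-- Each term is off by `|c_{u,v}|` times the mean of a nonnegative variable bounded by `alzerGap
v`. Absolute values are taken because the signs of the coefficients are not controlled. -/
theorem IsModel.abs_ccdf_sub_approxCCDF_le (hW : IsModel N W μ) {θ : ℝ} (hθ : 0 ≤ θ) :
    |N.ccdf W μ θ - N.approxCCDF θ| ≤ N.G * ∑ δ ∈ N.deltas, ∑ v ∈ Finset.Icc 1 (N.mult δ),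
      |N.coeff δ v| * alzerGap v := by
  rw [hW.ccdf_eq hθ, Params.approxCCDF, ← mul_sub, abs_mul, abs_of_pos N.G_pos,
    ← Finset.sum_sub_distrib]
  refine mul_le_mul_of_nonneg_left ?_ N.G_pos.le
  refine (Finset.abs_sum_le_sum_abs _ _).trans (Finset.sum_le_sum fun δ hδ => ?_)
  rw [← Finset.sum_sub_distrib]
  refine (Finset.abs_sum_le_sum_abs _ _).trans (Finset.sum_le_sum fun v hv => ?_)
  have hδ0 := (N.pos_of_mem_deltas hδ).le
  have hv1 := (Finset.mem_Icc.1 hv).1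
  have hl := Params.load_nonneg (N := N) (W := W) hδ0 hθ
  have hQ := hW.integrable_gammaQ_load hδ0 hθ hv1
  have ha := hW.integrable_alzer_load hδ0 hθ v
  rw [← mul_sub, abs_mul, ← hW.integral_alzer_load hδ0 hθ, abs_sub_comm, ← integral_sub ha hQ]
  refine mul_le_mul_of_nonneg_left ?_ (abs_nonneg _)
  rw [abs_of_nonneg (integral_nonneg fun ω => sub_nonneg.2 (gammaQ_le_alzer hv1 (hl ω)))]
  calc ∫ ω, (alzer v (N.load W δ θ ω) - gammaQ v (N.load W δ θ ω)) ∂μ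
      ≤ ∫ _, alzerGap v ∂μ :=
        integral_mono (ha.sub hQ) (integrable_const _)
          fun ω => alzer_sub_gammaQ_le_alzerGap hv1 (hl ω)
    _ = alzerGap v := by simp

end Coverage

end EHCluster

theorem theorem1 {K M : ℕ} (N : EHCluster.Params K M)
    {Ω : Type*} [MeasurableSpace Ω] (μ : Measure Ω) [IsProbabilityMeasure μ]
    (W : EHCluster.Vars Ω K M) (hW : EHCluster.IsModel N W μ) :
    -- the exact CCDF of the sum of Bernoulli-gated exponentials
    (∀ x : ℝ, 0 ≤ x → μ.real {ω | x < N.normSignal W ω} =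
      N.G * ∑ δ ∈ N.deltas, ∑ v ∈ Finset.Icc 1 (N.mult δ),
        N.coeff δ v * EHCluster.gammaQ v (δ ^ N.η * x)) ∧
    -- the interference is finite
    (∀ᵐ ω ∂μ, N.interference W ω < ∞) ∧
    -- Alzer's bound
    (∀ v : ℕ, 1 ≤ v → ∀ x : ℝ, 0 ≤ x → EHCluster.gammaQ v x ≤ EHCluster.alzer v x) ∧
    ∀ θ : ℝ, 0 ≤ θ →
      -- the exact CCDF of the SINR
      (N.ccdf W μ θ =
        N.G * ∑ δ ∈ N.deltas, ∑ v ∈ Finset.Icc 1 (N.mult δ),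
          N.coeff δ v * ∫ ω, EHCluster.gammaQ v (N.load W δ θ ω) ∂μ) ∧
      -- Alzer's bound of each expectation, in closed form
      (∀ δ ∈ N.deltas, ∀ v ∈ Finset.Icc 1 (N.mult δ),
        Integrable (fun ω => EHCluster.gammaQ v (N.load W δ θ ω)) μ ∧
        Integrable (fun ω => EHCluster.alzer v (N.load W δ θ ω)) μ ∧
        ∫ ω, EHCluster.gammaQ v (N.load W δ θ ω) ∂μ ≤
          ∫ ω, EHCluster.alzer v (N.load W δ θ ω) ∂μ ∧
        ∫ ω, EHCluster.alzer v (N.load W δ θ ω) ∂μ = N.B δ v θ) ∧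
      -- the error of the closed-form approximation
      |N.ccdf W μ θ - N.approxCCDF θ| ≤
        N.G * ∑ δ ∈ N.deltas, ∑ v ∈ Finset.Icc 1 (N.mult δ),
          |N.coeff δ v| * EHCluster.alzerGap v := by
  refine ⟨fun x hx => hW.ccdf_normSignal hx, hW.interference_lt_top,
    fun v hv x hx => EHCluster.gammaQ_le_alzer hv hx, fun θ hθ => ⟨hW.ccdf_eq hθ,
      fun δ hδ v hv => ?_, hW.abs_ccdf_sub_approxCCDF_le hθ⟩⟩
  have hδ0 := (N.pos_of_mem_deltas hδ).le
  have hv1 := (Finset.mem_Icc.1 hv).1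
  have hQ := hW.integrable_gammaQ_load hδ0 hθ hv1
  have ha := hW.integrable_alzer_load hδ0 hθ v
  exact ⟨hQ, ha, integral_mono hQ ha fun ω =>
    EHCluster.gammaQ_le_alzer hv1 (EHCluster.Params.load_nonneg hδ0 hθ ω),
    hW.integral_alzer_load hδ0 hθ v⟩
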